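/- Let $T$ be a complete first-order theory in a one-sorted language $L$, and let $\mathfrak C\models T$ be a monster model, i.e. a $\kappa$-saturated and strongly $\kappa$-homogeneous model for a cardinal $\kappa$ (any infinite $\kappa$ will do). Let $\bar c$ be an enumeration of $\mathfrak C$. **Types and flows.** For a tuple of variables $\bar x$, $S_{\bar x}(\mathfrak C)$ is the space of complete types over $\mathfrak C$, $S_{\bar x}(\emptyset)$ the space of complete types of $T$, and for $q\in S_{\bar x}(\emptyset)$, $S_q(\mathfrak C)\subseteq S_{\bar x}(\mathfrak C)$ is the closed subspace of types extending $q$; $\mathrm{Aut}(\mathfrak C)$ acts on it by $\sigma p=\{\varphi(\bar x,\sigma(\bar m)):\varphi(\bar x,\bar m)\in p\}$. Put $S_{\bar c}(\mathfrak C)=S_{\mathrm{tp}(\bar c/\emptyset)}(\mathfrak C)$ and let $\mathrm{Inv}_{\bar c}(\mathfrak C)$ be the set of its $\mathrm{Aut}(\mathfrak C)$-invariant elements. For a finite set $\Delta=\{\varphi_i(\bar x,\bar y)\}_{i<k}$ of $L$-formulas, where $\bar x$ corresponds to $\bar c$ and $\bar y$ is finite, and a finite $\bar p=\{p_j\}_{j<m}\subseteq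 S_{\bar y}(\emptyset)$, let $S_{\bar c,\Delta}(\bar p)$ be the space of complete $\Delta$-types over $\bigcup_{j<m}p_j(\mathfrak C)$ consistent with $\mathrm{tp}(\bar c/\emptyset)$, i.e. of restrictions of types in $S_{\bar c}(\mathfrak C)$ to the formulas $\varphi_i(\bar x,\bar b)^{\pm1}$ with $i<k$ and $\bar b$ realizing some $p_j$; it is a zero-dimensional compact $\mathrm{Aut}(\mathfrak C)$-flow. The Ellis semigroup $\mathrm{EL}(X)$ of a $G$-flow $X$ is the closure of $\{x\mapsto gx: g\in G\}$ in $X^X$ with the topology of pointwise convergence. **Amenability.** $T$ is *extremely amenable* if for every finite $n$ and every $q\in S_n(\emptyset)$ there is an $\mathrm{Aut}(\mathfrak C)$-invariant type in $S_q(\mathfrak C)$; $T$ is *amenable* if for every such $q$ there is an $\mathrm{Aut}(\mathfrak C)$-invariant regular Borel probability measure on $S_q(\mathfrak C)$. **Colorings.** For a finite tuple $\bar a$ in $\mathfrak C$ let $\binom{\mathfrak C}{\bar a}$ be the set of all $\bar a'$ in $\mathfrak C$ with $\bar a'\equiv\bar a$, and for a finite tuple $\bar b$ let $\binom{\bar b}{\bar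 a}$ be the set of those $\bar a'\in\binom{\mathfrak C}{\bar a}$ whose coordinates are among those of $\bar b$. We write $\bar a\subseteq\bar b$ if the coordinates of $\bar a$ are among those of $\bar b$. A coloring $c:\binom{\mathfrak C}{\bar a}\to 2^n$ is *definable* if there are formulas $\varphi_i(\bar x)$, $i<n$, with parameters in $\mathfrak C$ such that $c(\bar a')(i)=1\iff\ \models\varphi_i(\bar a')$. It is *externally definable* if there are formulas $\varphi_i(\bar x,\bar y)$ without parameters and types $p_i\in S_{\bar y}(\mathfrak C)$, $i<n$, such that $c(\bar a')(i)=1\iff\varphi_i(\bar a',\bar y)\in p_i$; if moreover all $\varphi_i$ are in $\Delta$ and all $p_i$ extend $q\in S_{\bar y}(\emptyset)$, it is an externally definable *$(\Delta,q)$-coloring*. (Here $\bar y$ may be infinite.) **Ramsey properties.** - $T$ has *DEERP* [*EDEERP*] if for all finite $\bar a\subseteq\bar b$ in $\mathfrak C$, all $n<\omega$ and every [externally] definable coloring $c:\binom{\mathfrak C}{\bar a}\to2^n$ there is $\bar b'\in\binom{\mathfrak C}{\bar b}$ such that $c$ is constant on $\binom{\bar b'}{\bar a}$. - $T$ has *separately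 finite EDEERdeg* if for every finite tuple $\bar a$ in $\mathfrak C$, every finite set $\Delta$ of formulas in variables $\bar x,\bar y$ with $|\bar x|=|\bar a|$, and every $q\in S_{\bar y}(\emptyset)$ there is $l<\omega$ such that for all finite $\bar b\supseteq\bar a$ in $\mathfrak C$, all $n<\omega$ and every externally definable $(\Delta,q)$-coloring $c:\binom{\mathfrak C}{\bar a}\to2^n$ there is $\bar b'\in\binom{\mathfrak C}{\bar b}$ with $\#c[\binom{\bar b'}{\bar a}]\le l$. - $T$ has *DEECRP* if for all $\epsilon>0$, all finite $\bar a\subseteq\bar b$ in $\mathfrak C$, all $n<\omega$ and every definable coloring $c:\binom{\mathfrak C}{\bar a}\to2^n$ there are $k<\omega$, $\lambda_0,\dots,\lambda_{k-1}\in[0,1]$ with $\sum_{j<k}\lambda_j=1$, and $\sigma_0,\dots,\sigma_{k-1}\in\mathrm{Aut}(\mathfrak C)$ such that for all $\bar a',\bar a''\in\binom{\bar b}{\bar a}$ and all $i<n$ $$\Bigl|\sum_{j<k}\lambda_jc(\sigma_j(\bar a'))(i)-\sum_{j<k}\lambda_jc(\sigma_j(\bar a''))(i)\Bigr|\le\epsilon;$$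 it has the *strong DEECRP* if this holds with $\epsilon=0$. **Theorem.** 1. $T$ has DEERP if and only if $T$ is extremely amenable. 2. $T$ has EDEERP if and only if there is $\eta\in\mathrm{EL}(S_{\bar c}(\mathfrak C))$ with $\mathrm{Im}(\eta)\subseteq\mathrm{Inv}_{\bar c}(\mathfrak C)$. 3. $T$ has separately finite EDEERdeg if and only if for all $\Delta$ and $\bar p$ as above there is $\eta\in\mathrm{EL}(S_{\bar c,\Delta}(\bar p))$ with finite image. 4. $T$ has DEECRP if and only if $T$ is amenable, and $T$ has the strong DEECRP if and only if $T$ is amenable. -/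

import Mathlib

open FirstOrder

universe u v w w'

namespace DefRamsey

/-! ### Flows and Ellis semigroups -/

/-- The Ellis semigroup `EL(X)` of a flow `(G, X)`: the closure, in `X → X` with the topology of
pointwise convergence, of the set of all translations `x ↦ g • x`. -/
def ellisSemigroup (G X : Type*) [SMul G X] [TopologicalSpace X] : Set (X → X) :=
  closure (Set.range fun (g : G) (x : X) => g • x)

variable {L : FirstOrder.Language.{u, v}} {M : Type w}

/-! ### Formulas with parameters -/

lemma realize_onSentence_reduct {L₁ L₂ : FirstOrder.Language} (f : L₁ →ᴸ L₂) (N : Type*)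
    [L₂.Structure N] (φ : L₁.Sentence) :
    N ⊨ f.onSentence φ ↔ @FirstOrder.Language.Sentence.Realize L₁ N (f.reduct N) φ := by
  let i1 : L₁.Structure N := f.reduct N
  exact FirstOrder.Language.LHom.realize_onSentence N f φ

/-- The `L(M)`-formula in variables `α` obtained from the `L`-formula `φ` in variables `β` by
replacing each `b : β` by the variable `a`, if `t b = Sum.inl a`, and by the parameter `m`,
if `t b = Sum.inr m`. -/
def instFormula {α β : Type*} (φ : L.Formula β) (t : β → α ⊕ M) : L[[M]].Formula α :=
  ((L.lhomWithConstants M).onFormula φ).subst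
    fun b => Sum.elim FirstOrder.Language.Term.var (fun m => (L.con m).term) (t b)

/-- A sentence with parameters and variables is evaluated in `N` as expected. -/
lemma realize_equivSentence_instFormula {α β N : Type*} [inst : L[[M]][[α]].Structure N]
    (φ : L.Formula β) (t : β → α ⊕ M) :
    N ⊨ FirstOrder.Language.Formula.equivSentence (instFormula φ t) ↔
      @FirstOrder.Language.Formula.Realize L N
        (((L[[M]].lhomWithConstants α).comp (L.lhomWithConstants M)).reduct N) β φ
        (fun b => Sum.elim (fun a => ((L[[M]].con a : L[[M]][[α]].Constants) : N))
          (fun m => (((L[[M]].lhomWithConstants α).onFunction (L.con m) :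
            L[[M]][[α]].Constants) : N)) (t b)) := by
  let i1 : L[[M]].Structure N := (L[[M]].lhomWithConstants α).reduct N
  let i2 : L.Structure N := (L.lhomWithConstants M).reduct N
  rw [FirstOrder.Language.Formula.realize_equivSentence]
  unfold instFormula FirstOrder.Language.Formula.Realize
  rw [FirstOrder.Language.BoundedFormula.realize_subst]
  refine (FirstOrder.Language.LHom.realize_onFormula (L.lhomWithConstants M) φ).trans ?_
  unfold FirstOrder.Language.Formula.Realize
  refine iff_of_eq (congrArg
    (fun f => FirstOrder.Language.BoundedFormula.Realize φ f default) (funext fun b => ?_))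
  rcases t b with a | m
  · rfl
  · simp only [Sum.elim_inr]
    rw [FirstOrder.Language.Term.realize_constants]
    rfl

/-- The change of parameters along `σ : M → M`, as a map of languages `L(M)(α) → L(M)(α)`. -/
def shift (σ : M → M) (α : Type w') : L[[M]][[α]] →ᴸ L[[M]][[α]] :=
  (L.lhomWithConstantsMap σ).addConstants α

lemma onSentence_comp {L₁ : FirstOrder.Language.{u, v}} {L₂ L₃ : FirstOrder.Language}
    (f : L₂ →ᴸ L₃) (g : L₁ →ᴸ L₂) (φ : L₁.Sentence) :
    (f.comp g).onSentence φ = f.onSentence (g.onSentence φ) :=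
  congrFun (FirstOrder.Language.LHom.comp_onBoundedFormula f g) φ

lemma shift_one (α : Type w') :
    (shift (L := L) (id : M → M) α) = FirstOrder.Language.LHom.id _ := by
  refine FirstOrder.Language.LHom.funext ?_ ?_
  · funext n f
    rcases f with (f | f) | f
    · rfl
    · cases n with
      | zero => rfl
      | succ n => exact isEmptyElim f
    · rfl
  · funext n f
    rcases f with (f | f) | f
    · rfl
    · exact isEmptyElim f
    · rfl

lemma shift_comp (f g : M → M) (α : Type w') :
    (shift (L := L) (f ∘ g) α) = (shift f α).comp (shift g α) := by
  refine FirstOrder.Language.LHom.funext ?_ ?_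
  · funext n f
    rcases f with (f | f) | f
    · rfl
    · cases n with
      | zero => rfl
      | succ n => exact isEmptyElim f
    · rfl
  · funext n f
    rcases f with (f | f) | f
    · rfl
    · exact isEmptyElim f
    · rfl

variable [L.Structure M]

/-! ### Automorphisms -/

/-- The automorphism group of a structure, under composition. -/
instance autGroup : Group (M ≃[L] M) where
  mul g h := g.comp h
  one := FirstOrder.Language.Equiv.refl L M
  inv g := g.symm
  mul_assoc _ _ _ := rfl
  one_mul _ := rfl
  mul_one _ := rfl
  inv_mul_cancel g := g.symm_comp_self

lemma aut_mul_apply (g h : M ≃[L] M) (x : M) : (g * h) x = g (h x) := rfl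

lemma aut_one_apply (x : M) : (1 : M ≃[L] M) x = x := rfl

lemma aut_apply_inv_self (g : M ≃[L] M) (x : M) : g (g⁻¹ x) = x := g.apply_symm_apply x

/-! ### Saturation, homogeneity, monster models -/

/-- `M` is `κ`-saturated: for every set `A ⊆ M` of fewer than `κ` elements, every complete type
over `A` in finitely many variables is realized in `M`. -/
def IsSaturated (L : FirstOrder.Language.{u, v}) (M : Type w) [L.Structure M] [Nonempty M]
    (κ : Cardinal.{w}) : Prop :=
  ∀ A : Set M, Cardinal.mk A < κ →
    ∀ (n : ℕ) (p : (L[[A]].completeTheory M).CompleteType (Fin n)),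
      p ∈ (L[[A]].completeTheory M).realizedTypes M (Fin n)

/-- `M` is strongly `κ`-homogeneous: every elementary map `f : A → M`, with `A ⊆ M` of fewer than
`κ` elements, extends to an automorphism of `M`. -/
def IsStronglyHomogeneous (L : FirstOrder.Language.{u, v}) (M : Type w) [L.Structure M]
    (κ : Cardinal.{w}) : Prop :=
  ∀ A : Set M, Cardinal.mk A < κ → ∀ f : A → M,
    (∀ φ : L.Formula A, φ.Realize (fun a : A => (a : M)) ↔ φ.Realize f) →
      ∃ σ : M ≃[L] M, ∀ a : A, σ a = f a

/-- `M` is a monster model of its theory, with degree of saturation the infinite cardinal `κ`. -/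
structure IsMonster (L : FirstOrder.Language.{u, v}) (M : Type w) [L.Structure M] [Nonempty M]
    (κ : Cardinal.{w}) : Prop where
  aleph0_le : Cardinal.aleph0 ≤ κ
  saturated : IsSaturated L M κ
  homogeneous : IsStronglyHomogeneous L M κ

/-! ### Global types -/

/-- The space `S_α(M)` of global types: complete types over `M` in variables indexed by `α`,
with the topology that Mathlib puts on spaces of complete types. -/
abbrev GlobalType (L : FirstOrder.Language.{u, v}) (M : Type w) [L.Structure M] (α : Type w') :=
  (L.elementaryDiagram M).CompleteType α

/-- The formula `φ`, with variables and parameters plugged in according to `t`, belongs to `p`. -/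
def Holds {α β : Type*} (p : GlobalType L M α) (φ : L.Formula β) (t : β → α ⊕ M) : Prop :=
  FirstOrder.Language.Formula.equivSentence (instFormula φ t) ∈ p

/-- Automorphisms preserve the elementary diagram, after the change of parameters. -/
lemma realize_shift (σ : M ≃[L] M) (φ : L[[M]].Sentence) :
    M ⊨ (L.lhomWithConstantsMap σ).onSentence φ ↔ M ⊨ φ := by
  rw [realize_onSentence_reduct]
  let e : @FirstOrder.Language.Equiv L[[M]] M M _ ((L.lhomWithConstantsMap σ).reduct M) := by
    refine @FirstOrder.Language.Equiv.mk L[[M]] M M _ ((L.lhomWithConstantsMap σ).reduct M)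
      σ.toEquiv ?_ ?_
    · intro n f x
      rcases f with f | f
      · exact σ.map_fun f x
      · cases n with
        | zero => rfl
        | succ n => exact isEmptyElim f
    · intro n r x
      rcases r with r | r
      · exact σ.map_rel r x
      · exact isEmptyElim r
  exact (@FirstOrder.Language.StrongHomClass.realize_sentence L[[M]] M M _
    ((L.lhomWithConstantsMap σ).reduct M) _ _
    (@FirstOrder.Language.Equiv.instStrongHomClass L[[M]] M M _
      ((L.lhomWithConstantsMap σ).reduct M)) e φ).symm

/-- The action of automorphisms on global types:
`σ p = {φ(x, m) | φ(x, σ⁻¹ m) ∈ p} = {φ(x, σ m) | φ(x, m) ∈ p}`. -/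
instance globalTypeSMul {α : Type w'} : SMul (M ≃[L] M) (GlobalType L M α) where
  smul σ p :=
    { toTheory := {φ | (shift (σ⁻¹ : M ≃[L] M) α).onSentence φ ∈ p}
      subset' := by
        rintro _ ⟨φ, hφ, rfl⟩
        refine p.subset ⟨(L.lhomWithConstantsMap (σ⁻¹ : M ≃[L] M)).onSentence φ, ?_, ?_⟩
        · exact (realize_shift σ⁻¹ φ).2 hφ
        · rw [← onSentence_comp, ← onSentence_comp]
          rfl
      isMaximal' := by
        refine ⟨?_, fun φ => p.mem_or_not_mem ((shift (σ⁻¹ : M ≃[L] M) α).onSentence φ)⟩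
        obtain ⟨N⟩ := p.isMaximal.1
        have h : @FirstOrder.Language.Theory.Model _ N ((shift (σ⁻¹ : M ≃[L] M) α).reduct N)
            {φ | (shift (σ⁻¹ : M ≃[L] M) α).onSentence φ ∈ p} :=
          @FirstOrder.Language.Theory.Model.mk _ N ((shift (σ⁻¹ : M ≃[L] M) α).reduct N) _
            fun φ hφ => (realize_onSentence_reduct _ N φ).1 (N.is_model.realize_of_mem _ hφ)
        exact @FirstOrder.Language.Theory.Model.isSatisfiable _ _ N N.nonempty'
          ((shift (σ⁻¹ : M ≃[L] M) α).reduct N) h }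

lemma mem_smul {α : Type w'} (σ : M ≃[L] M) (p : GlobalType L M α) (φ : L[[M]][[α]].Sentence) :
    φ ∈ σ • p ↔ (shift (σ⁻¹ : M ≃[L] M) α).onSentence φ ∈ p := Iff.rfl

instance globalTypeMulAction {α : Type w'} : MulAction (M ≃[L] M) (GlobalType L M α) where
  one_smul p := by
    refine SetLike.ext fun φ => ?_
    rw [mem_smul]
    have h : (shift ((1 : M ≃[L] M)⁻¹ : M ≃[L] M) α) =
        FirstOrder.Language.LHom.id L[[M]][[α]] := shift_one α
    rw [h]
    exact iff_of_eq (congrArg (· ∈ p)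
      (congrFun (FirstOrder.Language.LHom.id_onBoundedFormula) φ))
  mul_smul σ τ p := by
    refine SetLike.ext fun φ => ?_
    rw [mem_smul, mem_smul, mem_smul, ← onSentence_comp]
    have h : (shift ((σ * τ)⁻¹ : M ≃[L] M) α : L[[M]][[α]] →ᴸ L[[M]][[α]]) =
        (shift (τ⁻¹ : M ≃[L] M) α).comp (shift (σ⁻¹ : M ≃[L] M) α) := by
      rw [← shift_comp, mul_inv_rev]
      rfl
    rw [h]

lemma holds_smul {α β : Type*} (σ : M ≃[L] M) (p : GlobalType L M α) (φ : L.Formula β)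
    (t : β → α ⊕ M) :
    Holds (σ • p) φ t ↔ Holds p φ (fun b => Sum.map id (σ⁻¹ : M ≃[L] M) (t b)) := by
  unfold Holds
  rw [mem_smul]
  have key : ∀ N : p.toTheory.ModelType,
      N ⊨ (shift (σ⁻¹ : M ≃[L] M) α).onSentence
          (FirstOrder.Language.Formula.equivSentence (instFormula φ t)) ↔
        N ⊨ FirstOrder.Language.Formula.equivSentence
          (instFormula φ fun b => Sum.map id (σ⁻¹ : M ≃[L] M) (t b)) := by
    intro N
    rw [realize_onSentence_reduct]
    refine (@realize_equivSentence_instFormula _ _ _ _ N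
      ((shift (σ⁻¹ : M ≃[L] M) α).reduct N) φ t).trans ?_
    refine Iff.trans ?_ (realize_equivSentence_instFormula φ _).symm
    refine iff_of_eq ?_
    congr 1
    funext b
    rcases t b with a | m <;> rfl
  have h1 := p.isMaximal.mem_iff_models ((shift (σ⁻¹ : M ≃[L] M) α).onSentence
          (FirstOrder.Language.Formula.equivSentence (instFormula φ t)))
  have h2 := p.isMaximal.mem_iff_models (FirstOrder.Language.Formula.equivSentence
          (instFormula φ fun b => Sum.map id (σ⁻¹ : M ≃[L] M) (t b)))
  rw [FirstOrder.Language.Theory.models_sentence_iff] at h1 h2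
  exact h1.trans ((forall_congr' key).trans h2.symm)

/-! ### Spaces of global types extending a type over `∅` -/

variable {T : L.Theory}

/-- The space `S_q(M)` of global types extending the complete type `q` over `∅`. -/
def TypesExtending (M : Type w) [L.Structure M] {α : Type w'} (q : T.CompleteType α) :=
  {p : GlobalType L M α //
    ∀ φ : L.Formula α, FirstOrder.Language.Formula.equivSentence φ ∈ q → Holds p φ Sum.inl}

instance typesExtendingTopology {α : Type w'} (q : T.CompleteType α) :
    TopologicalSpace (TypesExtending M q) := instTopologicalSpaceSubtype

instance typesExtendingMeasurableSpace {α : Type w'} (q : T.CompleteType α) :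
    MeasurableSpace (TypesExtending M q) := borel _

instance typesExtendingBorelSpace {α : Type w'} (q : T.CompleteType α) :
    BorelSpace (TypesExtending M q) := ⟨rfl⟩

instance typesExtendingMulAction {α : Type w'} (q : T.CompleteType α) :
    MulAction (M ≃[L] M) (TypesExtending M q) where
  smul σ p := ⟨σ • p.1, fun φ hφ => (holds_smul σ p.1 φ Sum.inl).2 (p.2 φ hφ)⟩
  one_smul p := Subtype.ext (one_smul _ p.1)
  mul_smul σ τ p := Subtype.ext (mul_smul σ τ p.1)

/-- `T` is amenable (computed in the monster model `M`): for every finitary complete type `q` over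
`∅`, there is an invariant regular Borel probability measure on `S_q(M)`. -/
def IsAmenable (T : L.Theory) (M : Type w) [L.Structure M] : Prop :=
  ∀ (n : ℕ) (q : T.CompleteType (Fin n)),
    ∃ μ : MeasureTheory.Measure (TypesExtending M q),
      MeasureTheory.IsProbabilityMeasure μ ∧ μ.Regular ∧
        ∀ (σ : M ≃[L] M) (B : Set (TypesExtending M q)), MeasurableSet B →
          μ ((fun p => σ • p) ⁻¹' B) = μ B

/-- `T` is extremely amenable (computed in the monster model `M`): every finitary complete type
`q` over `∅` extends to an `Aut(M)`-invariant global type. -/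
def IsExtremelyAmenable (T : L.Theory) (M : Type w) [L.Structure M] : Prop :=
  ∀ (n : ℕ) (q : T.CompleteType (Fin n)),
    (MulAction.fixedPoints (M ≃[L] M) (TypesExtending M q)).Nonempty

variable [Nonempty M] [M ⊨ T]

lemma typeOf_aut_comp {α : Type w'} (σ : M ≃[L] M) (a : α → M) :
    T.typeOf (fun i => σ (a i)) = T.typeOf a := by
  refine SetLike.ext fun φ => ?_
  rw [FirstOrder.Language.Theory.CompleteType.mem_typeOf,
    FirstOrder.Language.Theory.CompleteType.mem_typeOf]
  exact FirstOrder.Language.StrongHomClass.realize_formula σ _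

/-! ### The spaces of `Δ`-types -/

/-- The tuples of `M` that realize one of the types in `P`. -/
def Realizations (M : Type w) [L.Structure M] [Nonempty M] [M ⊨ T] {m : ℕ}
    (P : Finset (T.CompleteType (Fin m))) :=
  {b : Fin m → M // T.typeOf b ∈ P}

/-- The space `S_{c,Δ}(P)` of complete `Δ`-types over the set of realizations of the types in `P`
that are consistent with `tp(c)`, where `Δ` is a finite set of formulas `φ(x, y)` with `x` reserved
for `c`. Such a `Δ`-type is coded by the function that tells, for `φ ∈ Δ` and a realization `b` of
one of the types in `P`, whether it contains `φ(x, b)` or `¬ φ(x, b)`; the topology is that of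
pointwise convergence. -/
def DeltaType (T : L.Theory) [M ⊨ T] {ι : Type w'} (c : ι → M) {m : ℕ}
    (Δ : Finset (L.Formula (ι ⊕ Fin m))) (P : Finset (T.CompleteType (Fin m))) :=
  {f : Δ → Realizations M P → Bool //
    ∃ p : TypesExtending M (T.typeOf c), ∀ (φ : Δ) (b : Realizations M P),
      f φ b = true ↔ Holds p.1 φ.1 (Sum.map id b.1)}

instance deltaTypeTopology {ι : Type w'} (c : ι → M) {m : ℕ}
    (Δ : Finset (L.Formula (ι ⊕ Fin m))) (P : Finset (T.CompleteType (Fin m))) :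
    TopologicalSpace (DeltaType T c Δ P) := instTopologicalSpaceSubtype

instance realizationsMulAction {m : ℕ} (P : Finset (T.CompleteType (Fin m))) :
    MulAction (M ≃[L] M) (Realizations M P) where
  smul σ b := ⟨fun i => σ (b.1 i), by rw [typeOf_aut_comp]; exact b.2⟩
  one_smul _ := rfl
  mul_smul _ _ _ := rfl

/-- The action of automorphisms on `Δ`-types: `φ(x, b) ∈ σ f` if and only if
`φ(x, σ⁻¹ b) ∈ f`. -/
instance deltaTypeMulAction {ι : Type w'} (c : ι → M) {m : ℕ}
    (Δ : Finset (L.Formula (ι ⊕ Fin m))) (P : Finset (T.CompleteType (Fin m))) :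
    MulAction (M ≃[L] M) (DeltaType T c Δ P) where
  smul σ f := ⟨fun φ b => f.1 φ (σ⁻¹ • b), by
    obtain ⟨p, hp⟩ := f.2
    refine ⟨σ • p, fun φ b => (hp φ (σ⁻¹ • b)).trans ?_⟩
    refine Iff.trans ?_ (holds_smul σ p.1 φ.1 (Sum.map id b.1)).symm
    refine iff_of_eq (congrArg _ (funext fun x => ?_))
    rcases x with x | x <;> rfl⟩
  one_smul f := Subtype.ext (funext fun φ => funext fun b => by
    change f.1 φ ((1 : M ≃[L] M)⁻¹ • b) = f.1 φ b
    rw [inv_one, one_smul])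
  mul_smul σ τ f := Subtype.ext (funext fun φ => funext fun b => by
    change f.1 φ ((σ * τ)⁻¹ • b) = f.1 φ (τ⁻¹ • σ⁻¹ • b)
    rw [mul_inv_rev, mul_smul])

/-! ### Copies and colorings -/

/-- `Copies T a` is the set `(M choose a)` of all realizations of `tp(a)` in `M`. -/
def Copies (T : L.Theory) [M ⊨ T] {k : ℕ} (a : Fin k → M) :=
  {a' : Fin k → M // T.typeOf a' = T.typeOf a}

/-- `copiesIn T a b` is the set `(b choose a)` of all realizations of `tp(a)` whose coordinates are
among the coordinates of `b`. -/
def copiesIn (T : L.Theory) [M ⊨ T] {k l : ℕ} (a : Fin k → M) (b : Fin l → M) :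
    Set (Copies T a) :=
  {a' | Set.range a'.1 ⊆ Set.range b}

/-- Automorphisms act on the copies of `a`. -/
instance copiesMulAction {k : ℕ} (a : Fin k → M) : MulAction (M ≃[L] M) (Copies T a) where
  smul σ a' := ⟨fun i => σ (a'.1 i), (typeOf_aut_comp σ a'.1).trans a'.2⟩
  one_smul _ := rfl
  mul_smul _ _ _ := rfl

/-- A coloring of the copies of `a` with colors in `2 ^ n`. -/
abbrev Coloring (T : L.Theory) [M ⊨ T] {k : ℕ} (a : Fin k → M) (n : ℕ) :=
  Copies T a → Fin n → Fin 2

/-- A coloring is definable if it is given by `n` formulas with parameters in `M`. -/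
def IsDefinableColoring {k n : ℕ} {a : Fin k → M} (c : Coloring T a n) : Prop :=
  ∃ φ : Fin n → L[[M]].Formula (Fin k), ∀ (a' : Copies T a) (i : Fin n),
    c a' i = 1 ↔ (φ i).Realize a'.1

/-- A coloring is externally definable if it is given by `n` formulas `φ i (x, y)` without
parameters and `n` global types `p i (y)`, where `y` is a tuple of variables of any length. -/
def IsExternallyDefinableColoring {k n : ℕ} {a : Fin k → M} (c : Coloring T a n) : Prop :=
  ∃ (γ : Type w) (φ : Fin n → L.Formula (Fin k ⊕ γ)) (p : Fin n → GlobalType L M γ),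
    ∀ (a' : Copies T a) (i : Fin n),
      c a' i = 1 ↔ Holds (p i) (φ i) (Sum.elim (fun j => Sum.inr (a'.1 j)) Sum.inl)

/-- An externally definable `(Δ, q)`-coloring: the formulas are in `Δ`, and the global types
extend `q`. -/
def IsExternallyDefinableDeltaColoring {k n : ℕ} {a : Fin k → M} {γ : Type w'}
    (Δ : Finset (L.Formula (Fin k ⊕ γ))) (q : T.CompleteType γ) (c : Coloring T a n) : Prop :=
  ∃ (φ : Fin n → Δ) (p : Fin n → TypesExtending M q),
    ∀ (a' : Copies T a) (i : Fin n),
      c a' i = 1 ↔ Holds (p i).1 (φ i).1 (Sum.elim (fun j => Sum.inr (a'.1 j)) Sum.inl)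

/-! ### Ramsey properties -/

/-- A set is monochromatic if the coloring takes exactly one value on it. -/
def IsMonochromatic {X Y : Type*} (c : X → Y) (S : Set X) : Prop :=
  ∃ y, c '' S = {y}

/-- The definable elementary embedding Ramsey property. -/
def DEERP (T : L.Theory) (M : Type w) [L.Structure M] [Nonempty M] [M ⊨ T] : Prop :=
  ∀ (k l : ℕ) (a : Fin k → M) (b : Fin l → M), Set.range a ⊆ Set.range b →
    ∀ (n : ℕ) (c : Coloring T a n), IsDefinableColoring c →
      ∃ b' : Copies T b, IsMonochromatic c (copiesIn T a b'.1)

/-- The externally definable elementary embedding Ramsey property. -/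
def EDEERP (T : L.Theory) (M : Type w) [L.Structure M] [Nonempty M] [M ⊨ T] : Prop :=
  ∀ (k l : ℕ) (a : Fin k → M) (b : Fin l → M), Set.range a ⊆ Set.range b →
    ∀ (n : ℕ) (c : Coloring T a n), IsExternallyDefinableColoring c →
      ∃ b' : Copies T b, IsMonochromatic c (copiesIn T a b'.1)

/-- Separately finite externally definable elementary embedding Ramsey degree. The bound `d`
depends on `a`, `Δ` and `q` only. -/
def SepFinEDEERdeg (T : L.Theory) (M : Type w) [L.Structure M] [Nonempty M] [M ⊨ T] : Prop :=
  ∀ (k : ℕ) (a : Fin k → M) (γ : Type w) (Δ : Finset (L.Formula (Fin k ⊕ γ)))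
    (q : T.CompleteType γ), ∃ d : ℕ,
    ∀ (l : ℕ) (b : Fin l → M), Set.range a ⊆ Set.range b →
      ∀ (n : ℕ) (c : Coloring T a n), IsExternallyDefinableDeltaColoring Δ q c →
        ∃ b' : Copies T b, (c '' copiesIn T a b'.1).ncard ≤ d

/-- For every definable coloring `c` of the copies of `a`, and every `b ⊇ a`, some convex
combination of translates of `c` is constant up to `ε` on the copies of `a` in `b`. -/
def ConvexRamseyUpTo (T : L.Theory) (M : Type w) [L.Structure M] [Nonempty M] [M ⊨ T]
    (ε : ℝ) : Prop :=
  ∀ (k l : ℕ) (a : Fin k → M) (b : Fin l → M), Set.range a ⊆ Set.range b →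
    ∀ (n : ℕ) (c : Coloring T a n), IsDefinableColoring c →
      ∃ (r : ℕ) (lam : Fin r → ℝ) (σ : Fin r → (M ≃[L] M)),
        (∀ j, lam j ∈ Set.Icc (0 : ℝ) 1) ∧ ∑ j, lam j = 1 ∧
          ∀ a' ∈ copiesIn T a b, ∀ a'' ∈ copiesIn T a b, ∀ i : Fin n,
            |∑ j, lam j * ((c (σ j • a') i : ℕ) : ℝ) -
              ∑ j, lam j * ((c (σ j • a'') i : ℕ) : ℝ)| ≤ ε

/-- The definable elementary embedding convex Ramsey property. -/
def DEECRP (T : L.Theory) (M : Type w) [L.Structure M] [Nonempty M] [M ⊨ T] : Prop :=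
  ∀ ε : ℝ, 0 < ε → ConvexRamseyUpTo T M ε

/-- The strong definable elementary embedding convex Ramsey property. -/
def StrongDEECRP (T : L.Theory) (M : Type w) [L.Structure M] [Nonempty M] [M ⊨ T] : Prop :=
  ConvexRamseyUpTo T M 0

end DefRamsey

/-! Colorings and types are dual. For a formula `ψ(y, x)` and a tuple `m`, the color of `τσa` under
`x ↦ ψ(m, x)` is the truth value of `ψ(τ⁻¹m, σa)` (`holds_conjType_inv`). For an external coloring
given by a global type `p`, it is the answer to whether `τ⁻¹p` contains `ψ(y, σa)`. Hence a
monochromatic copy `τb` yields a translate that passes finitely many tests of invariance. In the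
other direction, saturation and homogeneity make the types of conjugates of `m` dense among the
global extensions of `tp(m)` (`exists_aut_holds_iff`), so a global type can be imitated by an
automorphism on the finitely many copies of `a` in `b`.

Parts 1 and 2: the Ramsey property satisfies any finitely many invariance conditions, and
compactness of the type space, respectively of the Ellis semigroup, satisfies all of them at once.
Conversely, an automorphism that imitates the invariant type, respectively `η`, moves `b` to a
monochromatic copy. External types in arbitrary variables are first moved to variables for the
enumeration `c` (`exists_lift_of_surjective`).

Part 3: if at most `d` colors survive on some copy, a pigeonhole argument gives a bound `N`,
independent of the number of `Δ`-types colored, such that among more than `N` of them two agree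
after translation on any prescribed finite set (`exists_agree_of_sepFin`). A limit of such
translations has at most `N` values. Conversely, a finite image leaves only finitely many color
patterns.

Part 4: a convex combination of translates of a coloring is a finitely supported measure on
conjugate types, and a limit of almost invariant measures is invariant. Conversely, only finitely
many truth patterns occur over the copies of `a` in `b`, and their measures are weights with no
error at all. This is why the strong and the approximate property coincide. -/

namespace DefRamsey

open FirstOrder.Language

/-! ### Truth of formulas in global types. -/

section Calculus

variable {L : FirstOrder.Language.{u, v}} {M : Type w}

lemma realize_instFormula {α β N : Type*} [L.Structure N] [L[[M]].Structure N]
    [(L.lhomWithConstants M).IsExpansionOn N] (φ : L.Formula β) (t : β → α ⊕ M) (x : α → N) :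
    (instFormula φ t).Realize x ↔
      φ.Realize (fun b => Sum.elim x (fun m => ((L.con m : L[[M]].Constants) : N)) (t b)) := by
  unfold instFormula Formula.Realize
  rw [BoundedFormula.realize_subst]
  refine (LHom.realize_onFormula (L.lhomWithConstants M) φ).trans ?_
  unfold Formula.Realize
  refine iff_of_eq (congrArg (fun f => BoundedFormula.Realize φ f default) (funext fun b => ?_))
  rcases t b with a | m
  · rfl
  · simp only [Sum.elim_inr]
    rw [Term.realize_constants]

variable [L.Structure M]

/-- The global type of a tuple of elements of `M`. -/
def globalTypeOf [Nonempty M] {α : Type w'} (x : α → M) : GlobalType L M α :=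
  (L.elementaryDiagram M).typeOf x

lemma holds_typeOf {α β N : Type*} [L.Structure N] [L[[M]].Structure N]
    [(L.lhomWithConstants M).IsExpansionOn N] [Nonempty N] [N ⊨ L.elementaryDiagram M]
    (x : α → N) (φ : L.Formula β) (t : β → α ⊕ M) :
    Holds ((L.elementaryDiagram M).typeOf x) φ t ↔
      φ.Realize (fun b => Sum.elim x (fun m => ((L.con m : L[[M]].Constants) : N)) (t b)) := by
  unfold Holds
  rw [Theory.CompleteType.formula_mem_typeOf, realize_instFormula]

lemma holds_globalTypeOf [Nonempty M] {α β : Type*} (x : α → M) (φ : L.Formula β)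
    (t : β → α ⊕ M) :
    Holds (globalTypeOf x) φ t ↔ φ.Realize (fun b => Sum.elim x id (t b)) :=
  holds_typeOf x φ t

/-- Every global type is the type of a tuple in an elementary extension. -/
lemma exists_realization {α : Type w'} (p : GlobalType L M α) :
    ∃ (N : Type (max u w v w')) (_ : L.Structure N) (_ : L[[M]].Structure N)
      (_ : (L.lhomWithConstants M).IsExpansionOn N) (_ : Nonempty N)
      (_ : N ⊨ L.elementaryDiagram M) (x : α → N), (L.elementaryDiagram M).typeOf x = p := by
  obtain ⟨N, x, hx⟩ := Theory.exists_modelType_is_realized_in _ p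
  let _ := (L.lhomWithConstants M).reduct N
  exact ⟨N, inferInstance, inferInstance, LHom.isExpansionOn_reduct _ _, inferInstance,
    N.is_model, x, hx⟩

variable {α β γ : Type*} (p : GlobalType L M α)

lemma holds_relabel (φ : L.Formula β) (e : β → γ) (t : γ → α ⊕ M) :
    Holds p (φ.relabel e) t ↔ Holds p φ (t ∘ e) := by
  obtain ⟨N, _, _, _, _, _, x, rfl⟩ := exists_realization p
  simp only [holds_typeOf, Formula.realize_relabel]
  rfl

lemma holds_not (φ : L.Formula β) (t : β → α ⊕ M) : Holds p φ.not t ↔ ¬ Holds p φ t := by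
  obtain ⟨N, _, _, _, _, _, x, rfl⟩ := exists_realization p
  simp only [holds_typeOf, Formula.realize_not]

lemma holds_sup (φ ψ : L.Formula β) (t : β → α ⊕ M) :
    Holds p (φ ⊔ ψ) t ↔ Holds p φ t ∨ Holds p ψ t := by
  obtain ⟨N, _, _, _, _, _, x, rfl⟩ := exists_realization p
  simp only [holds_typeOf, Formula.realize_sup]

lemma holds_bot (t : β → α ⊕ M) : ¬ Holds p (⊥ : L.Formula β) t := by
  obtain ⟨N, _, _, _, _, _, x, rfl⟩ := exists_realization p
  simp only [holds_typeOf, Formula.realize_bot, not_false_eq_true]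

lemma holds_congr {φ ψ : L.Formula β} (h : φ ⇔[∅] ψ) (t : β → α ⊕ M) :
    Holds p φ t ↔ Holds p ψ t := by
  obtain ⟨N, _, _, _, _, _, x, rfl⟩ := exists_realization p
  simp only [holds_typeOf]
  exact h.realize_iff

/-- Constants for elements of `M` become variables, and `ψ` does not depend on `p`. Membership of
sentences can thus always be replaced by `Holds` for formulas without parameters. -/
lemma exists_formula_holds (s : L[[M]][[α]].Sentence) :
    ∃ ψ : L.Formula (α ⊕ M), ∀ p : GlobalType L M α, s ∈ p ↔ Holds p ψ id := by
  refine ⟨Formula.relabel Sum.swap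
    (BoundedFormula.constantsVarsEquiv (Formula.equivSentence.symm s)), fun p => ?_⟩
  obtain ⟨N, _, _, _, _, _, x, rfl⟩ := exists_realization p
  rw [holds_typeOf, Theory.CompleteType.mem_typeOf, Formula.realize_relabel]
  unfold Formula.Realize
  rw [← BoundedFormula.realize_constantsVarsEquiv]
  refine iff_of_eq (congrArg (fun f => BoundedFormula.Realize _ f _) (funext fun b => ?_))
  rcases b with b | b <;> rfl

variable {p} in
lemma globalType_ext {q : GlobalType L M α}
    (h : ∀ ψ : L.Formula (α ⊕ M), Holds p ψ id ↔ Holds q ψ id) : p = q := by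
  refine SetLike.ext fun s => ?_
  obtain ⟨ψ, hψ⟩ := exists_formula_holds s
  rw [hψ, hψ, h]

lemma isClopen_holds (φ : L.Formula β) (t : β → α ⊕ M) :
    IsClopen {p : GlobalType L M α | Holds p φ t} :=
  CompleteType.isClopen_typesWith _

/-- The global types that contain `ψ` form a basis of the topology. -/
lemma exists_holds_subset {p : GlobalType L M α} {U : Set (GlobalType L M α)}
    (hU : IsOpen U) (hp : p ∈ U) :
    ∃ ψ : L.Formula (α ⊕ M), Holds p ψ id ∧ ∀ q : GlobalType L M α, Holds q ψ id → q ∈ U := by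
  obtain ⟨_, ⟨s, rfl⟩, hs, hsU⟩ :=
    CompleteType.isTopologicalBasis_range_typesWith.exists_subset_of_mem_open hp hU
  obtain ⟨ψ, hψ⟩ := exists_formula_holds s
  exact ⟨ψ, (hψ p).1 hs, fun q hq => hsU ((hψ q).2 hq)⟩

end Calculus

/-! ### Reduction to finitely many variables. -/

section FiniteSupport

variable {L : FirstOrder.Language.{u, v}} {M : Type w}

/-- Finitely many formulas use finitely many variables. -/
lemma exists_relabel_iff {α γ I : Type*} [Finite I] (ψ : I → L.Formula (α ⊕ γ)) :
    ∃ (k : ℕ) (e : Fin k → γ) (ψ' : I → L.Formula (α ⊕ Fin k)),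
      ∀ i, ψ i ⇔[∅] (ψ' i).relabel (Sum.map id e) := by
  classical
  -- Only the `γ`-side is cut down, to one finite list that serves all `ψ i`; the possibly infinite
  -- `α`-side is kept.
  have hfin : (⋃ i, {c : γ | Sum.inr c ∈ (ψ i).freeVarFinset}).Finite :=
    Set.finite_iUnion fun i => (ψ i).freeVarFinset.finite_toSet.preimage Sum.inr_injective.injOn
  have := hfin.to_subtype
  obtain ⟨k, ⟨e⟩⟩ := Finite.exists_equiv_fin (⋃ i, {c : γ | Sum.inr c ∈ (ψ i).freeVarFinset})
  have key : ∀ i, ∃ f : (ψ i).freeVarFinset → α ⊕ Fin k,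
      ∀ x, Sum.map id (fun j => (e.symm j).1) (f x) = x.1 := by
    intro i
    choose f hf using show ∀ x : (ψ i).freeVarFinset, ∃ y : α ⊕ Fin k,
        Sum.map id (fun j => (e.symm j).1) y = x.1 by
      rintro ⟨x | x, hx⟩
      · exact ⟨Sum.inl x, rfl⟩
      · exact ⟨Sum.inr (e ⟨x, Set.mem_iUnion.2 ⟨i, hx⟩⟩), by simp⟩
    exact ⟨f, hf⟩
  choose f hf using key
  refine ⟨k, fun j => (e.symm j).1, fun i => (ψ i).restrictFreeVar (f i), fun i N v xs => ?_⟩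
  rw [Subsingleton.elim xs default, BoundedFormula.realize_iff]
  refine Iff.symm ((Formula.realize_relabel (φ := (ψ i).restrictFreeVar (f i))).trans ?_)
  exact BoundedFormula.realize_restrictFreeVar v fun x => congrArg v (hf i x)

lemma exists_relabel_iff_left {α γ I : Type*} [Finite I] (ψ : I → L.Formula (γ ⊕ α)) :
    ∃ (k : ℕ) (e : Fin k → γ) (ψ' : I → L.Formula (Fin k ⊕ α)),
      ∀ i, ψ i ⇔[∅] (ψ' i).relabel (Sum.map e id) := by
  obtain ⟨k, e, ψ', h⟩ := exists_relabel_iff fun i => (ψ i).relabel Sum.swap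
  refine ⟨k, e, fun i => (ψ' i).relabel Sum.swap, fun i N v xs => ?_⟩
  rw [Subsingleton.elim xs default, BoundedFormula.realize_iff]
  have := (h i).realize_iff (M := N) (v := v ∘ Sum.swap)
  rw [Formula.realize_relabel, Formula.realize_relabel] at this
  refine Iff.trans (iff_of_eq ?_) (this.trans ?_)
  · rw [Function.comp_assoc, Sum.swap_swap_eq]; rfl
  · change _ ↔ Formula.Realize (((ψ' i).relabel Sum.swap).relabel (Sum.map e id)) v
    rw [Formula.realize_relabel, Formula.realize_relabel]
    refine iff_of_eq (congrArg (ψ' i).Realize (funext fun b => ?_))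
    rcases b with b | b <;> rfl

end FiniteSupport

/-! ### Finite consequences of saturation and homogeneity. -/

section Monster

variable {L : FirstOrder.Language.{u, v}} {M : Type w} [L.Structure M] [Nonempty M]
  {κ : Cardinal.{w}}

/-- Tuples with the same type are conjugate. -/
lemma exists_aut_apply_eq (hM : IsMonster L M κ) {n : ℕ} {x y : Fin n → M}
    (h : ∀ φ : L.Formula (Fin n), φ.Realize x ↔ φ.Realize y) :
    ∃ σ : M ≃[L] M, ∀ i, σ (x i) = y i := by
  have hcard : Cardinal.mk (Set.range x) < κ :=
    (Cardinal.lt_aleph0_of_finite _).trans_le hM.aleph0_le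
  let f : Set.range x → M := fun a => y a.2.choose
  have hf : ∀ i, f ⟨x i, i, rfl⟩ = y i := by
    intro i
    have hc : x (Set.mem_range_self (f := x) i).choose = x i :=
      (Set.mem_range_self (f := x) i).choose_spec
    -- The equality formula makes `f` well defined: repeated entries of `x` are repeated in `y`.
    have := h ((Term.var (Set.mem_range_self (f := x) i).choose).equal (Term.var i))
    simp only [Formula.realize_equal, Term.realize_var] at this
    exact this.1 hc
  obtain ⟨σ, hσ⟩ := hM.homogeneous (Set.range x) hcard f fun φ => by
    choose g hg using fun a : Set.range x => a.2
    have := h (φ.relabel g)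
    rw [Formula.realize_relabel, Formula.realize_relabel] at this
    refine Iff.trans (iff_of_eq ?_) (this.trans (iff_of_eq ?_))
    · exact congrArg φ.Realize (funext fun a => (hg a).symm)
    · exact congrArg φ.Realize
        (funext fun a => (hf (g a)).symm.trans (congrArg f (Subtype.ext (hg a))))
  exact ⟨σ, fun i => (hσ ⟨x i, i, rfl⟩).trans (hf i)⟩

/-- The restriction of a global type to finitely many variables and parameters is realized. -/
lemma exists_tuple_holds_iff (hM : IsMonster L M κ) {γ : Type*} (p : GlobalType L M γ) {n : ℕ}
    (s : Fin n → γ) {A : Set M} (hA : A.Finite) :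
    ∃ x : Fin n → M, ∀ φ : L.Formula (Fin n ⊕ A),
      Holds p φ (Sum.map s Subtype.val) ↔ φ.Realize (Sum.elim x Subtype.val) := by
  obtain ⟨N, _, _, _, _, _, y, rfl⟩ := exists_realization p
  have := hA.to_subtype
  have hcard : Cardinal.mk A < κ := (Cardinal.lt_aleph0_of_finite _).trans_le hM.aleph0_le
  let j := ElementaryEmbedding.ofModelsElementaryDiagram L M N
  -- Interpreting `A` along the elementary embedding turns `N` into a model of the theory of `M`
  -- over `A`, so that saturation applies to the type of `y ∘ s` over `A`.
  let _ : (constantsOn A).Structure N := constantsOn.structure fun a : A => j a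
  have hN : N ⊨ L[[A]].completeTheory M := by
    refine ⟨fun φ hφ => ?_⟩
    have hφ' : M ⊨ φ := hφ
    rw [← Formula.realize_equivSentence_symm_con] at hφ' ⊢
    exact (j.map_formula _ _).2 hφ'
  obtain ⟨x, hx⟩ := hM.saturated A hcard n ((L[[A]].completeTheory M).typeOf (y ∘ s))
  refine ⟨x, fun φ => ?_⟩
  have h := SetLike.ext_iff.1 hx (Formula.equivSentence (instFormula (M := A) φ id))
  rw [Theory.CompleteType.formula_mem_typeOf, Theory.CompleteType.formula_mem_typeOf,
    realize_instFormula, realize_instFormula] at h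
  rw [holds_typeOf]
  refine Iff.trans (iff_of_eq (congrArg φ.Realize (funext fun b => ?_))) (h.symm.trans
    (iff_of_eq (congrArg φ.Realize (funext fun b => ?_))))
  · rcases b with b | b <;> rfl
  · rcases b with b | b <;> rfl

end Monster

/-! ### Global types extending a type over the empty set, and their approximation by conjugates. -/

section Extending

variable {L : FirstOrder.Language.{u, v}} {M : Type w} [L.Structure M] {T : L.Theory}

lemma holds_inl_iff {α : Type*} {q : T.CompleteType α} (p : TypesExtending M q)
    (φ : L.Formula α) : Holds p.1 φ Sum.inl ↔ Formula.equivSentence φ ∈ q := by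
  refine ⟨fun h => ?_, p.2 φ⟩
  by_contra hn
  rw [← Theory.CompleteType.not_mem_iff, ← Formula.equivSentence_not] at hn
  exact (holds_not _ _ _).1 (p.2 _ hn) h

lemma isClopen_typesExtending_holds {α β : Type*} (q : T.CompleteType α) (φ : L.Formula β)
    (t : β → α ⊕ M) : IsClopen {p : TypesExtending M q | Holds p.1 φ t} :=
  (isClopen_holds φ t).preimage continuous_subtype_val

instance typesExtendingT2Space {α : Type w'} (q : T.CompleteType α) :
    T2Space (TypesExtending M q) :=
  inferInstanceAs (T2Space {_p : GlobalType L M α // _})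

instance typesExtendingCompactSpace {α : Type w'} (q : T.CompleteType α) :
    CompactSpace (TypesExtending M q) := by
  refine isCompact_iff_compactSpace.1 (IsClosed.isCompact ?_)
  change IsClosed {p : GlobalType L M α |
    ∀ φ : L.Formula α, Formula.equivSentence φ ∈ q → Holds p φ Sum.inl}
  simp only [Set.ofPred_forall]
  exact isClosed_iInter fun φ => isClosed_iInter fun _ => (isClopen_holds φ Sum.inl).1

lemma sum_map_one (α : Type*) : (Sum.map id (1 : M ≃[L] M) : α ⊕ M → α ⊕ M) = id :=
  Sum.map_id_id

/-- A global type is invariant if and only if the truth of its formulas depends only on the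
conjugacy class of the parameters. -/
lemma smul_eq_self_iff {α : Type*} {q : T.CompleteType α} (p : TypesExtending M q) :
    p ∈ MulAction.fixedPoints (M ≃[L] M) (TypesExtending M q) ↔
      ∀ (σ : M ≃[L] M) (ψ : L.Formula (α ⊕ M)),
        Holds p.1 ψ (Sum.map id σ) ↔ Holds p.1 ψ id := by
  have key : ∀ (σ : M ≃[L] M) (ψ : L.Formula (α ⊕ M)),
      Holds (σ • p).1 ψ id ↔ Holds p.1 ψ (Sum.map id (σ⁻¹ : M ≃[L] M)) :=
    fun σ ψ => holds_smul σ p.1 ψ id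
  constructor
  · intro h σ ψ
    have := key σ⁻¹ ψ
    rw [inv_inv, h σ⁻¹] at this
    exact this.symm
  · intro h σ
    exact Subtype.ext (globalType_ext fun ψ => (key σ ψ).trans (h σ⁻¹ ψ))

variable [Nonempty M] [M ⊨ T]

lemma holds_inl_iff_realize {α : Type*} {x : α → M} (p : TypesExtending M (T.typeOf x))
    (φ : L.Formula α) : Holds p.1 φ Sum.inl ↔ φ.Realize x := by
  rw [holds_inl_iff, Theory.CompleteType.formula_mem_typeOf]

lemma realize_iff_of_typeOf_eq {α : Type*} {x y : α → M} (h : T.typeOf x = T.typeOf y)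
    (φ : L.Formula α) : φ.Realize x ↔ φ.Realize y := by
  rw [← Theory.CompleteType.formula_mem_typeOf (T := T), h,
    Theory.CompleteType.formula_mem_typeOf]

lemma typeOf_eq_of_realize_iff {α : Type*} {x y : α → M}
    (h : ∀ φ : L.Formula α, φ.Realize x ↔ φ.Realize y) : T.typeOf x = T.typeOf y :=
  SetLike.ext fun _ => by
    rw [Theory.CompleteType.mem_typeOf, Theory.CompleteType.mem_typeOf, h]

/-- The global type of a conjugate of `x`. -/
def conjType (T : L.Theory) [M ⊨ T] {α : Type*} (x : α → M) (σ : M ≃[L] M) :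
    TypesExtending M (T.typeOf x) :=
  ⟨globalTypeOf fun a => σ (x a), fun φ h => by
    rw [Theory.CompleteType.formula_mem_typeOf] at h
    rw [holds_globalTypeOf]
    exact (StrongHomClass.realize_formula σ φ).2 h⟩

lemma holds_conjType {α β : Type*} (x : α → M) (σ : M ≃[L] M) (φ : L.Formula β)
    (t : β → α ⊕ M) :
    Holds (conjType T x σ).1 φ t ↔ φ.Realize fun b => Sum.elim (fun a => σ (x a)) id (t b) :=
  holds_globalTypeOf _ φ t

variable {κ : Cardinal.{w}}

/-- Applying `τ` turns `ψ'(τ⁻¹x, σa)` into `ψ'(x, τσa)`. This is the dictionary between moving the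
type and moving the colored tuple. -/
lemma holds_conjType_inv {n k : ℕ} (x : Fin n → M) {a : Fin k → M} {ψ : L.Formula (Fin n ⊕ M)}
    {ψ' : L.Formula (Fin n ⊕ Fin k)} (h : ψ ⇔[∅] ψ'.relabel (Sum.map id a))
    (τ σ : M ≃[L] M) :
    Holds (conjType T x τ⁻¹).1 ψ (Sum.map id σ) ↔
      ψ'.Realize (Sum.elim x fun j => τ (σ (a j))) := by
  rw [holds_congr _ h, holds_relabel, holds_conjType, ← StrongHomClass.realize_formula τ]
  refine iff_of_eq (congrArg ψ'.Realize (funext fun b => ?_))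
  rcases b with b | b
  · exact aut_apply_inv_self τ (x b)
  · rfl

/-- A global type is approximated by types of conjugates. -/
lemma exists_aut_holds_iff (hM : IsMonster L M κ) {γ I : Type*} [Finite I]
    (p : GlobalType L M γ) {n : ℕ} (s : Fin n → γ) (x : Fin n → M)
    (h : ∀ φ : L.Formula (Fin n), Holds p φ (fun j => Sum.inl (s j)) ↔ φ.Realize x)
    (ψ : I → L.Formula (Fin n ⊕ M)) :
    ∃ σ : M ≃[L] M, ∀ i,
      Holds p (ψ i) (Sum.map s id) ↔ (ψ i).Realize (Sum.elim (fun j => σ (x j)) id) := by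
  obtain ⟨k, e, ψ', hψ⟩ := exists_relabel_iff ψ
  obtain ⟨y, hy⟩ := exists_tuple_holds_iff hM p s (Set.finite_range e)
  -- Saturation realizes `p` over the finitely many relevant parameters by some `y`; as `y` has the
  -- type of `x` over the empty set, homogeneity makes it a conjugate of `x`.
  obtain ⟨σ, hσ⟩ := exists_aut_apply_eq hM (x := x) (y := y) fun φ => by
    have := hy (φ.relabel Sum.inl)
    rw [holds_relabel, Formula.realize_relabel] at this
    exact (h φ).symm.trans this
  refine ⟨σ, fun i => ?_⟩
  have := hy ((ψ' i).relabel (Sum.map id (Set.rangeFactorization e)))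
  rw [holds_relabel, Formula.realize_relabel] at this
  rw [holds_congr p (hψ i), (hψ i).realize_iff, holds_relabel, Formula.realize_relabel]
  refine Iff.trans (iff_of_eq (congrArg (Holds p (ψ' i)) (funext fun b => ?_))) (this.trans
    (iff_of_eq (congrArg (ψ' i).Realize (funext fun b => ?_))))
  · rcases b with b | b <;> rfl
  · rcases b with b | b
    · exact (hσ b).symm
    · rfl

/-- A global type in variables `γ` whose restriction to the variables `s` extends the type of
the subtuple `x ∘ e` can be transferred to a global type extending the type of `x`. -/
lemma exists_lift (hM : IsMonster L M κ) {γ : Type*} {ι : Type w'}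
    (p : GlobalType L M γ) {n : ℕ} (s : Fin n → γ)
    (x : ι → M) (e : Fin n → ι)
    (h : ∀ φ : L.Formula (Fin n),
      Holds p φ (fun j => Sum.inl (s j)) ↔ φ.Realize fun j => x (e j)) :
    ∃ p' : TypesExtending M (T.typeOf x), ∀ ψ : L.Formula (Fin n ⊕ M),
      Holds p'.1 ψ (Sum.map e id) ↔ Holds p ψ (Sum.map s id) := by
  have key := CompactSpace.iInter_nonempty (X := TypesExtending M (T.typeOf x))
    (t := fun ψ : L.Formula (Fin n ⊕ M) =>
      {p' | Holds p'.1 ψ (Sum.map e id) ↔ Holds p ψ (Sum.map s id)}) ?_ ?_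
  · obtain ⟨p', hp'⟩ := key
    exact ⟨p', Set.mem_iInter.1 hp'⟩
  · intro ψ
    by_cases hp : Holds p ψ (Sum.map s id)
    · simp only [hp, iff_true]
      exact (isClopen_typesExtending_holds _ _ _).1
    · simp only [hp, iff_false]
      exact (isClopen_typesExtending_holds _ _ _).compl.1
  · intro S
    -- A conjugate of the subtuple `x ∘ e` meets finitely many conditions; the same automorphism
    -- applied to all of `x` supplies the remaining coordinates.
    obtain ⟨σ, hσ⟩ := exists_aut_holds_iff hM p s _ h fun ψ : S => ψ.1
    refine ⟨conjType T x σ, Set.mem_iInter₂.2 fun ψ hψ => ?_⟩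
    refine Iff.trans ?_ (hσ ⟨ψ, hψ⟩).symm
    rw [holds_conjType]
    refine iff_of_eq (congrArg ψ.Realize (funext fun b => ?_))
    rcases b with b | b <;> rfl

/-- Finitary types over `∅` are realized. -/
lemma exists_typeOf_eq (hM : IsMonster L M κ) (hT : T.IsComplete) {n : ℕ}
    (q : T.CompleteType (Fin n)) : ∃ x : Fin n → M, T.typeOf x = q := by
  have key := CompactSpace.iInter_nonempty (X := GlobalType L M (Fin n))
    (t := fun ψ : {ψ : L.Formula (Fin n) // Formula.equivSentence ψ ∈ q} =>
      {p | Holds p ψ.1 Sum.inl}) (fun ψ => (isClopen_holds _ _).1) ?_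
  · obtain ⟨p, hp⟩ := key
    -- With no parameters, saturation realizes precisely the restriction of `p` to the empty set,
    -- which is `q`.
    obtain ⟨x, hx⟩ := exists_tuple_holds_iff hM p id (Set.finite_empty (α := M))
    have hx' : ∀ ψ : L.Formula (Fin n), Holds p ψ Sum.inl ↔ ψ.Realize x := fun ψ => by
      have := hx (ψ.relabel Sum.inl)
      rw [holds_relabel, Formula.realize_relabel] at this
      exact this
    let p' : TypesExtending M q := ⟨p, fun ψ hψ => Set.mem_iInter.1 hp ⟨ψ, hψ⟩⟩
    refine ⟨x, SetLike.ext fun s => ?_⟩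
    obtain ⟨ψ, rfl⟩ := Formula.equivSentence.surjective s
    rw [Theory.CompleteType.formula_mem_typeOf, ← holds_inl_iff p']
    exact (hx' ψ).symm
  · intro S
    obtain ⟨N, y, hy⟩ := Theory.exists_modelType_is_realized_in _ q
    -- Completeness of `T` is used here: the existential sentence expressing consistency of a finite
    -- part of `q` passes from `N` to `M`.
    let χ : L.Sentence :=
      ((Formula.iInf fun ψ : S => ψ.1.1).relabel (Sum.inr : _ → Empty ⊕ Fin n)).iExs (Fin n)
    have hχ : N ⊨ χ := by
      refine Formula.realize_iExs.2 ⟨y, ?_⟩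
      rw [Formula.realize_relabel]
      refine Formula.realize_iInf.2 fun ψ => ?_
      exact (Theory.CompleteType.formula_mem_typeOf (T := T)).1
        (show _ ∈ T.typeOf y by rw [hy]; exact ψ.1.2)
    have hχ' : M ⊨ χ := (hT.realize_sentence_iff χ M).2 ((hT.realize_sentence_iff χ N).1 hχ)
    obtain ⟨x, hx⟩ := Formula.realize_iExs.1 hχ'
    rw [Formula.realize_relabel] at hx
    refine ⟨globalTypeOf x, Set.mem_iInter₂.2 fun ψ hψ => ?_⟩
    exact (holds_globalTypeOf x _ _).2 (Formula.realize_iInf.1 hx ⟨ψ, hψ⟩)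

end Extending

lemma isClopen_iff {X : Type*} [TopologicalSpace X] {P Q : X → Prop} (hP : IsClopen {x | P x})
    (hQ : IsClopen {x | Q x}) : IsClopen {x | P x ↔ Q x} := by
  have h : {x | P x ↔ Q x} = {x | P x} ∩ {x | Q x} ∪ {x | P x}ᶜ ∩ {x | Q x}ᶜ := by
    ext x
    exact iff_iff_and_or_not_and_not
  rw [h]
  exact (hP.inter hQ).union (hP.compl.inter hQ.compl)

lemma fin_two_eq_iff {x y : Fin 2} : x = y ↔ (x = 1 ↔ y = 1) := by
  omega

/-! ### Copies of finite tuples, and colorings as finite families of predicates. -/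

section Copies

variable {L : FirstOrder.Language.{u, v}} {M : Type w} [L.Structure M] [Nonempty M]
  {T : L.Theory} [M ⊨ T] {κ : Cardinal.{w}} {k l : ℕ}

/-- A tuple as a copy of itself. -/
def Copies.self (T : L.Theory) [M ⊨ T] (a : Fin k → M) : Copies T a := ⟨a, rfl⟩

/-- The translate of a tuple as a copy. -/
def Copies.translate (T : L.Theory) [M ⊨ T] (σ : M ≃[L] M) (b : Fin l → M) : Copies T b :=
  σ • Copies.self T b

lemma exists_smul_eq (hM : IsMonster L M κ) {a : Fin k → M} (x y : Copies T a) :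
    ∃ σ : M ≃[L] M, σ • x = y := by
  obtain ⟨σ, hσ⟩ := exists_aut_apply_eq hM (realize_iff_of_typeOf_eq (x.2.trans y.2.symm))
  exact ⟨σ, Subtype.ext (funext hσ)⟩

lemma smul_mem_copiesIn {a : Fin k → M} {b : Fin l → M} (σ : M ≃[L] M) {x : Copies T a}
    (hx : x ∈ copiesIn T a b) : σ • x ∈ copiesIn T a (fun i => σ (b i)) := by
  rintro _ ⟨j, rfl⟩
  obtain ⟨i, hi⟩ := hx ⟨j, rfl⟩
  exact ⟨i, congrArg σ hi⟩

lemma inv_smul_mem_copiesIn {a : Fin k → M} {b : Fin l → M} (σ : M ≃[L] M) {x : Copies T a}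
    (hx : x ∈ copiesIn T a (Copies.translate T σ b).1) : σ⁻¹ • x ∈ copiesIn T a b := by
  have := smul_mem_copiesIn σ⁻¹ hx
  have h : (fun i => σ⁻¹ ((Copies.translate T σ b).1 i)) = b :=
    funext fun i => σ.symm_apply_apply (b i)
  rwa [h] at this

lemma copiesIn_finite (a : Fin k → M) (b : Fin l → M) : (copiesIn T a b).Finite := by
  refine Set.Finite.of_finite_image (f := Subtype.val)
    ((Set.Finite.pi' fun _ : Fin k => Set.finite_range b).subset ?_) Subtype.val_injective.injOn
  rintro _ ⟨x, hx, rfl⟩ i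
  exact hx ⟨i, rfl⟩

lemma copiesIn_nonempty (hM : IsMonster L M κ) {a : Fin k → M} {b : Fin l → M}
    (h : Set.range a ⊆ Set.range b) (b' : Copies T b) : (copiesIn T a b'.1).Nonempty := by
  obtain ⟨σ, rfl⟩ := exists_smul_eq hM (Copies.self T b) b'
  exact ⟨σ • Copies.self T a, smul_mem_copiesIn σ h⟩

/-- Finitely many translates of a tuple can be collected in one tuple. -/
lemma exists_tuple_translates {J : Type*} [Finite J] (a : Fin k → M) (F : J → (M ≃[L] M)) :
    ∃ (l : ℕ) (b : Fin l → M), Set.range a ⊆ Set.range b ∧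
      ∀ j, F j • Copies.self T a ∈ copiesIn T a b := by
  obtain ⟨l, ⟨e⟩⟩ := Finite.exists_equiv_fin (Option J × Fin k)
  let g : Option J × Fin k → M := fun x => (x.1.elim 1 F : M ≃[L] M) (a x.2)
  have hg : ∀ x, g x ∈ Set.range (g ∘ e.symm) := fun x => ⟨e x, by simp⟩
  refine ⟨l, g ∘ e.symm, ?_, fun j => ?_⟩
  · rintro _ ⟨i, rfl⟩
    exact hg (none, i)
  · rintro _ ⟨i, rfl⟩
    exact hg (some j, i)

lemma exists_translate_eq (hM : IsMonster L M κ) {b : Fin l → M} (b' : Copies T b) :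
    ∃ τ : M ≃[L] M, ∀ {k : ℕ} {a : Fin k → M} {x : Copies T a},
      x ∈ copiesIn T a b → τ • x ∈ copiesIn T a b'.1 := by
  obtain ⟨τ, rfl⟩ := exists_smul_eq hM (Copies.self T b) b'
  exact ⟨τ, smul_mem_copiesIn τ⟩

/-- Collect `a` and all the `F j a` in one tuple `b`. Its monochromatic copy is `τb` for some `τ`,
and it contains every `τ(F j a)` as well as `τa`. -/
lemma exists_aut_of_isMonochromatic (hM : IsMonster L M κ) {J : Type*} [Finite J] {n : ℕ}
    {a : Fin k → M} {c : Coloring T a n}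
    (h : ∀ (l : ℕ) (b : Fin l → M), Set.range a ⊆ Set.range b →
      ∃ b' : Copies T b, IsMonochromatic c (copiesIn T a b'.1))
    (F : J → (M ≃[L] M)) :
    ∃ τ : M ≃[L] M, ∀ j, c (τ • F j • Copies.self T a) = c (τ • Copies.self T a) := by
  obtain ⟨l, b, hab, hb⟩ := exists_tuple_translates (T := T) a F
  obtain ⟨b', y, hy⟩ := h l b hab
  obtain ⟨τ, hτ⟩ := exists_translate_eq hM b'
  have h1 : c (τ • Copies.self T a) = y := hy.subset ⟨_, hτ hab, rfl⟩
  have h2 : ∀ j, c (τ • F j • Copies.self T a) = y := fun j => hy.subset ⟨_, hτ (hb j), rfl⟩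
  exact ⟨τ, fun j => (h2 j).trans h1.symm⟩

/-- A finite family of predicates, as a coloring. -/
lemma exists_coloring {I : Type*} [Finite I] (a : Fin k → M) (P : I → Copies T a → Prop) :
    ∃ (n : ℕ) (e : I ≃ Fin n) (c : Coloring T a n), ∀ x i, c x i = 1 ↔ P (e.symm i) x := by
  classical
  obtain ⟨n, ⟨e⟩⟩ := Finite.exists_equiv_fin I
  refine ⟨n, e, fun x i => if P (e.symm i) x then 1 else 0, fun x i => ?_⟩
  by_cases h : P (e.symm i) x <;> simp [h]

/-- Gathering all parameters in a single finite tuple `m` makes it possible to treat `m` as a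
realization and to vary it within its type. -/
lemma isDefinableColoring_iff {n : ℕ} {a : Fin k → M} (c : Coloring T a n) :
    IsDefinableColoring c ↔ ∃ (r : ℕ) (m : Fin r → M) (ψ : Fin n → L.Formula (Fin r ⊕ Fin k)),
      ∀ x i, c x i = 1 ↔ (ψ i).Realize (Sum.elim m x.1) := by
  constructor
  · rintro ⟨φ, hφ⟩
    obtain ⟨r, m, ψ, hψ⟩ := exists_relabel_iff_left
      fun i => (BoundedFormula.constantsVarsEquiv (φ i) : L.Formula (M ⊕ Fin k))
    refine ⟨r, m, ψ, fun x i => (hφ x i).trans ?_⟩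
    have h1 : (φ i).Realize x.1 ↔
        Formula.Realize (BoundedFormula.constantsVarsEquiv (φ i) : L.Formula (M ⊕ Fin k))
          (Sum.elim id x.1) :=
      BoundedFormula.realize_constantsVarsEquiv.symm
    rw [h1, (hψ i).realize_iff, Formula.realize_relabel, Sum.elim_comp_map]
    rfl
  · rintro ⟨r, m, ψ, hψ⟩
    refine ⟨fun i => instFormula (ψ i) (Sum.elim (fun j => Sum.inr (m j)) Sum.inl),
      fun x i => (hψ x i).trans ?_⟩
    rw [realize_instFormula]
    refine iff_of_eq (congrArg (ψ i).Realize (funext fun b => ?_))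
    rcases b with b | b <;> rfl

end Copies

/-! ### Part 1: definable colorings and invariant types. -/

section ExtremelyAmenable

variable {L : FirstOrder.Language.{u, v}} {M : Type w} [L.Structure M] [Nonempty M]
  {T : L.Theory} [M ⊨ T] {κ : Cardinal.{w}}

lemma DEERP.exists_aut (h : DEERP T M) (hM : IsMonster L M κ) {k r : ℕ} (a : Fin k → M)
    (m : Fin r → M) {I J : Type*} [Finite I] [Finite J] (ψ : I → L.Formula (Fin r ⊕ Fin k))
    (F : J → (M ≃[L] M)) :
    ∃ τ : M ≃[L] M, ∀ i j, (ψ i).Realize (Sum.elim m fun x => τ (F j (a x))) ↔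
      (ψ i).Realize (Sum.elim m fun x => τ (a x)) := by
  obtain ⟨n, e, c, hc⟩ := exists_coloring (T := T) a fun i x => (ψ i).Realize (Sum.elim m x.1)
  obtain ⟨τ, hτ⟩ := exists_aut_of_isMonochromatic hM (fun l b hab => h k l a b hab n c
    ((isDefinableColoring_iff c).2 ⟨r, m, fun i => ψ (e.symm i), hc⟩)) F
  refine ⟨τ, fun i j => ?_⟩
  have h1 := hc (τ • Copies.self T a) (e i)
  have h2 := hc (τ • F j • Copies.self T a) (e i)
  rw [e.symm_apply_apply] at h1 h2
  rw [hτ j] at h2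
  exact h2.symm.trans h1

/-- Invariance is a family of clopen conditions, one for each automorphism and formula. Finitely
many of them are met by the type of `τ⁻¹m`, where `τ` makes the associated coloring constant. -/
lemma isExtremelyAmenable_of_DEERP (hT : T.IsComplete) (hM : IsMonster L M κ) (h : DEERP T M) :
    IsExtremelyAmenable T M := by
  intro n q
  obtain ⟨m, rfl⟩ := exists_typeOf_eq hM hT q
  have key := CompactSpace.iInter_nonempty (X := TypesExtending M (T.typeOf m))
    (t := fun i : (M ≃[L] M) × L.Formula (Fin n ⊕ M) =>
      {p | Holds p.1 i.2 (Sum.map id i.1) ↔ Holds p.1 i.2 id})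
    (fun i => (isClopen_iff (isClopen_typesExtending_holds _ _ _)
      (isClopen_typesExtending_holds _ _ _)).1) ?_
  · obtain ⟨p, hp⟩ := key
    exact ⟨p, (smul_eq_self_iff p).2 fun σ ψ => Set.mem_iInter.1 hp (σ, ψ)⟩
  · intro S
    obtain ⟨k, a, ψ', hψ⟩ := exists_relabel_iff fun i : S => i.1.2
    obtain ⟨τ, hτ⟩ := h.exists_aut hM a m ψ' fun i : S => i.1.1
    refine ⟨conjType T m τ⁻¹, Set.mem_iInter₂.2 fun i hi => ?_⟩
    have h1 := holds_conjType_inv (T := T) m (hψ ⟨i, hi⟩) τ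
    have h2 := h1 1
    rw [sum_map_one] at h2
    exact (h1 i.1).trans ((hτ ⟨i, hi⟩ ⟨i, hi⟩).trans h2.symm)

/-- Realizing a global type over the copies of `a` in `b`. -/
lemma exists_aut_realize_iff (hM : IsMonster L M κ) {r k l n : ℕ} {m : Fin r → M}
    (p : TypesExtending M (T.typeOf m)) (ψ : Fin n → L.Formula (Fin r ⊕ Fin k))
    (a : Fin k → M) (b : Fin l → M) :
    ∃ σ : M ≃[L] M, ∀ x ∈ copiesIn T a b, ∀ i,
      Holds p.1 (ψ i) (Sum.map id x.1) ↔ (ψ i).Realize (Sum.elim m (σ • x).1) := by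
  have := (copiesIn_finite (T := T) a b).to_subtype
  obtain ⟨σ, hσ⟩ := exists_aut_holds_iff hM p.1 id m (holds_inl_iff_realize p)
    fun i : copiesIn T a b × Fin n => (ψ i.2).relabel (Sum.map id i.1.1.1)
  refine ⟨σ⁻¹, fun x hx i => ?_⟩
  have := hσ (⟨x, hx⟩, i)
  rw [holds_relabel, Formula.realize_relabel, ← StrongHomClass.realize_formula σ⁻¹] at this
  refine Iff.trans (iff_of_eq (congrArg (Holds p.1 (ψ i)) (funext fun b => ?_))) (this.trans
    (iff_of_eq (congrArg (ψ i).Realize (funext fun b => ?_))))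
  · rcases b with b | b <;> rfl
  · rcases b with b | b
    · exact σ.symm_apply_apply (m b)
    · rfl

lemma DEERP_of_isExtremelyAmenable (hM : IsMonster L M κ) (h : IsExtremelyAmenable T M) :
    DEERP T M := by
  intro k l a b hab n c hc
  obtain ⟨r, m, ψ, hψ⟩ := (isDefinableColoring_iff c).1 hc
  obtain ⟨p, hp⟩ := h r (T.typeOf m)
  rw [smul_eq_self_iff] at hp
  obtain ⟨σ, hσ⟩ := exists_aut_realize_iff hM p ψ a b
  obtain ⟨x₀, hx₀⟩ := copiesIn_nonempty hM hab (Copies.translate T σ b)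
  -- On copies inside `σb` the coloring reads off `p`, and `p` is invariant, so the color is the one
  -- that `p` assigns to `a`.
  refine ⟨Copies.translate T σ b, c x₀, ?_⟩
  have key : ∀ x ∈ copiesIn T a (Copies.translate T σ b).1, ∀ i,
      c x i = 1 ↔ Holds p.1 (ψ i) (Sum.map id a) := by
    intro x hx i
    have h1 := hσ _ (inv_smul_mem_copiesIn σ hx) i
    rw [smul_inv_smul] at h1
    rw [hψ, ← h1]
    obtain ⟨τ, hτ⟩ := exists_smul_eq hM (Copies.self T a) (σ⁻¹ • x)
    have h2 := hp τ ((ψ i).relabel (Sum.map id a))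
    rw [holds_relabel, holds_relabel] at h2
    refine Iff.trans (iff_of_eq (congrArg (Holds p.1 (ψ i)) (funext fun b => ?_))) h2
    rw [← hτ]
    rcases b with b | b <;> rfl
  refine Set.Subset.antisymm ?_ (Set.singleton_subset_iff.2 ⟨x₀, hx₀, rfl⟩)
  rintro _ ⟨x, hx, rfl⟩
  exact funext fun i => fin_two_eq_iff.2 ((key x hx i).trans (key x₀ hx₀ i).symm)

end ExtremelyAmenable

/-! ### Compactness and approximation in the Ellis semigroup. -/

section Ellis

variable {G X : Type*} [SMul G X] [TopologicalSpace X]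

/-- Compactness of the Ellis semigroup of a compact flow. -/
lemma exists_mem_ellisSemigroup [CompactSpace X] {K : Type*} (t : K → Set (X → X))
    (ht : ∀ i, IsClosed (t i))
    (h : ∀ S : Finset K, ∃ g : G, ∀ i ∈ S, (fun x => g • x) ∈ t i) :
    ∃ η ∈ ellisSemigroup G X, ∀ i, η ∈ t i := by
  obtain ⟨η, h1, h2⟩ := (isClosed_closure.isCompact :
    IsCompact (ellisSemigroup G X)).inter_iInter_nonempty t ht fun S => by
      obtain ⟨g, hg⟩ := h S
      exact ⟨_, subset_closure ⟨g, rfl⟩, Set.mem_iInter₂.2 hg⟩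
  exact ⟨η, h1, Set.mem_iInter.1 h2⟩

/-- Finitely many clopen conditions on values at finitely many points define an open neighborhood of
`η`, which therefore contains a translation. -/
lemma exists_smul_mem_iff {η : X → X} (hη : η ∈ ellisSemigroup G X) {I : Type*} [Finite I]
    (x : I → X) (C : I → Set X) (hC : ∀ i, IsClopen (C i)) :
    ∃ g : G, ∀ i, g • x i ∈ C i ↔ η (x i) ∈ C i := by
  have hopen : IsOpen (⋂ i, {ζ : X → X | ζ (x i) ∈ C i ↔ η (x i) ∈ C i}) := by
    refine isOpen_iInter_of_finite fun i => IsClopen.isOpen ?_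
    refine isClopen_iff ((hC i).preimage (continuous_apply (x i))) ?_
    by_cases h : η (x i) ∈ C i
    · simp only [h]
      exact isClopen_univ
    · simp only [h]
      exact isClopen_empty
  obtain ⟨_, h1, g, rfl⟩ := mem_closure_iff.1 hη _ hopen (Set.mem_iInter.2 fun i => Iff.rfl)
  exact ⟨g, Set.mem_iInter.1 h1⟩

end Ellis

/-! ### Part 2: externally definable colorings and the Ellis semigroup. -/

section External

variable {L : FirstOrder.Language.{u, v}} {M : Type w} [L.Structure M] [Nonempty M]
  {T : L.Theory} [M ⊨ T] {κ : Cardinal.{w}}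

lemma EDEERP.exists_aut (h : EDEERP T M) (hM : IsMonster L M κ) {k : ℕ} (a : Fin k → M)
    {γ : Type w} {I J : Type*} [Finite I] [Finite J] (p : I → GlobalType L M γ)
    (ψ : I → L.Formula (γ ⊕ Fin k)) (F : J → (M ≃[L] M)) :
    ∃ τ : M ≃[L] M, ∀ i j, Holds (p i) (ψ i) (Sum.map id fun x => τ (F j (a x))) ↔
      Holds (p i) (ψ i) (Sum.map id fun x => τ (a x)) := by
  obtain ⟨n, e, c, hc⟩ := exists_coloring (T := T) a
    fun i x => Holds (p i) (ψ i) (Sum.map id x.1)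
  obtain ⟨τ, hτ⟩ := exists_aut_of_isMonochromatic hM (fun l b hab => h k l a b hab n c
    ⟨γ, fun i => (ψ (e.symm i)).relabel Sum.swap, fun i => p (e.symm i), fun x i => by
      rw [hc, holds_relabel]
      refine iff_of_eq (congrArg (Holds (p (e.symm i)) (ψ (e.symm i))) (funext fun b => ?_))
      rcases b with b | b <;> rfl⟩) F
  refine ⟨τ, fun i j => ?_⟩
  have h1 := hc (τ • Copies.self T a) (e i)
  have h2 := hc (τ • F j • Copies.self T a) (e i)
  rw [e.symm_apply_apply] at h1 h2
  rw [hτ j] at h2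
  exact h2.symm.trans h1

/-- One coloring may involve several global types, so a single `τ⁻¹` makes finitely many types
invariant for finitely many tests simultaneously. The limit `η` does so for all of them. -/
lemma exists_ellis_of_EDEERP (hM : IsMonster L M κ) {ι : Type w} (c : ι → M) (h : EDEERP T M) :
    ∃ η ∈ ellisSemigroup (M ≃[L] M) (TypesExtending M (T.typeOf c)),
      Set.range η ⊆ MulAction.fixedPoints (M ≃[L] M) (TypesExtending M (T.typeOf c)) := by
  have key := exists_mem_ellisSemigroup (G := M ≃[L] M)
    (X := TypesExtending M (T.typeOf c))
    (fun i : (M ≃[L] M) × L.Formula (ι ⊕ M) × TypesExtending M (T.typeOf c) =>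
      {η | Holds (η i.2.2).1 i.2.1 (Sum.map id i.1) ↔ Holds (η i.2.2).1 i.2.1 id})
    (fun i => (isClopen_iff
      ((isClopen_typesExtending_holds _ i.2.1 (Sum.map id i.1)).preimage (continuous_apply i.2.2))
      ((isClopen_typesExtending_holds _ i.2.1 id).preimage (continuous_apply i.2.2))).1) ?_
  · obtain ⟨η, hη, hη'⟩ := key
    refine ⟨η, hη, ?_⟩
    rintro _ ⟨p, rfl⟩
    exact (smul_eq_self_iff _).2 fun σ ψ => hη' (σ, ψ, p)
  · intro S
    obtain ⟨k, a, ψ', hψ⟩ := exists_relabel_iff fun i : S => i.1.2.1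
    obtain ⟨τ, hτ⟩ := h.exists_aut hM a (fun i : S => i.1.2.2.1) ψ' fun i : S => i.1.1
    have h1 : ∀ (i : S) (σ : M ≃[L] M),
        Holds (τ⁻¹ • i.1.2.2).1 i.1.2.1 (Sum.map id σ) ↔
          Holds i.1.2.2.1 (ψ' i) (Sum.map id fun x => τ (σ (a x))) := by
      intro i σ
      rw [holds_congr _ (hψ i), holds_relabel]
      refine (holds_smul τ⁻¹ i.1.2.2.1 _ _).trans ?_
      rw [inv_inv]
      refine iff_of_eq (congrArg (Holds i.1.2.2.1 (ψ' i)) (funext fun b => ?_))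
      rcases b with b | b <;> rfl
    refine ⟨τ⁻¹, fun i hi => ?_⟩
    have h2 := h1 ⟨i, hi⟩ 1
    rw [sum_map_one] at h2
    exact (h1 ⟨i, hi⟩ i.1).trans ((hτ ⟨i, hi⟩ ⟨i, hi⟩).trans h2.symm)

/-- The variables of a global type that occur in finitely many formulas can be replaced by
variables for an enumeration of the model. -/
lemma exists_lift_of_surjective (hM : IsMonster L M κ) {ι γ : Type*} {c : ι → M}
    (hc : Function.Surjective c) (p : GlobalType L M γ) {r : ℕ} (s : Fin r → γ) :
    ∃ e : Fin r → ι, ∀ p₁ : GlobalType L M γ,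
      (∀ φ : L.Formula γ, Holds p₁ φ Sum.inl ↔ Holds p φ Sum.inl) →
      ∃ p' : TypesExtending M (T.typeOf c), ∀ {k : ℕ} (φ : L.Formula (Fin k ⊕ Fin r))
        (x : Fin k → M), Holds p'.1 φ (Sum.elim (fun j => Sum.inr (x j)) fun j => Sum.inl (e j)) ↔
          Holds p₁ φ (Sum.elim (fun j => Sum.inr (x j)) fun j => Sum.inl (s j)) := by
  obtain ⟨y, hy⟩ := exists_tuple_holds_iff hM p s (Set.finite_empty (α := M))
  -- The indices `e` depend on `p` only through its restriction to the empty set, so they serve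
  -- every `p₁` with that restriction. Part 3 needs this uniformity.
  choose e he using fun j => hc (y j)
  refine ⟨e, fun p₁ h => ?_⟩
  obtain ⟨p', hp'⟩ := exists_lift (T := T) hM p₁ s c e fun φ => by
    have h1 := h (φ.relabel s)
    have h2 := hy (φ.relabel Sum.inl)
    rw [holds_relabel, holds_relabel] at h1
    rw [holds_relabel, Formula.realize_relabel] at h2
    exact h1.trans (h2.trans (iff_of_eq (congrArg φ.Realize (funext fun j => (he j).symm))))
  refine ⟨p', fun φ x => ?_⟩
  have h1 := hp' (φ.relabel (Sum.elim (fun j => Sum.inr (x j)) Sum.inl))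
  rw [holds_relabel, holds_relabel] at h1
  refine Iff.trans (iff_of_eq (congrArg (Holds p'.1 φ) (funext fun b => ?_))) (h1.trans
    (iff_of_eq (congrArg (Holds p₁ φ) (funext fun b => ?_))))
  · rcases b with b | b <;> rfl
  · rcases b with b | b <;> rfl

lemma EDEERP_of_exists_ellis (hM : IsMonster L M κ) {ι : Type w} {c : ι → M}
    (hc : Function.Surjective c)
    (h : ∃ η ∈ ellisSemigroup (M ≃[L] M) (TypesExtending M (T.typeOf c)),
      Set.range η ⊆ MulAction.fixedPoints (M ≃[L] M) (TypesExtending M (T.typeOf c))) :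
    EDEERP T M := by
  obtain ⟨η, hη, hinv⟩ := h
  rintro k l a b hab n d ⟨γ, φ, p, hd⟩
  obtain ⟨r, s, φ', hφ⟩ := exists_relabel_iff φ
  choose e he using fun i => exists_lift_of_surjective (T := T) hM hc (p i) s
  choose p' hp' using fun i => he i (p i) fun _ => Iff.rfl
  have := (copiesIn_finite (T := T) a b).to_subtype
  -- `g` imitates `η` on the types `p' i`, tested at the copies of `a` in `b`. The color of `x` in
  -- `g⁻¹b` is decided by `g • p' i` at `g • x`, hence by the invariant type `η (p' i)`.
  obtain ⟨g, hg⟩ := exists_smul_mem_iff hη (fun i : copiesIn T a b × Fin n => p' i.2)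
    (fun i => {q | Holds q.1 (φ' i.2)
      (Sum.elim (fun j => Sum.inr (i.1.1.1 j)) fun j => Sum.inl (e i.2 j))})
    fun i => isClopen_typesExtending_holds _ _ _
  obtain ⟨x₀, hx₀⟩ := copiesIn_nonempty hM hab (Copies.translate T g⁻¹ b)
  refine ⟨Copies.translate T g⁻¹ b, d x₀, ?_⟩
  have key : ∀ x ∈ copiesIn T a (Copies.translate T g⁻¹ b).1, ∀ i,
      d x i = 1 ↔ Holds (η (p' i)).1 (φ' i)
        (Sum.elim (fun j => Sum.inr (a j)) fun j => Sum.inl (e i j)) := by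
    intro x hx i
    have hx' := inv_smul_mem_copiesIn g⁻¹ hx
    rw [inv_inv] at hx'
    have h1 : d x i = 1 ↔ Holds (p' i).1 (φ' i)
        (Sum.elim (fun j => Sum.inr (x.1 j)) fun j => Sum.inl (e i j)) := by
      rw [hd, hp', holds_congr _ (hφ i), holds_relabel]
      refine iff_of_eq (congrArg (Holds (p i) (φ' i)) (funext fun b => ?_))
      rcases b with b | b <;> rfl
    have h2 := (holds_smul g (p' i).1 (φ' i)
      (Sum.elim (fun j => Sum.inr ((g • x).1 j)) fun j => Sum.inl (e i j)))
    have h3 := hg (⟨g • x, hx'⟩, i)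
    obtain ⟨τ, hτ⟩ := exists_smul_eq hM (Copies.self T a) (g • x)
    have h4 := (smul_eq_self_iff _).1 (hinv ⟨p' i, rfl⟩) τ ((φ' i).relabel
      (Sum.elim (fun j => Sum.inr (a j)) fun j => Sum.inl (e i j)))
    rw [holds_relabel, holds_relabel] at h4
    rw [h1]
    refine Iff.trans (iff_of_eq (congrArg (Holds (p' i).1 (φ' i)) (funext fun b => ?_)))
      (h2.symm.trans (h3.trans (Iff.trans (iff_of_eq (congrArg (Holds (η (p' i)).1 (φ' i))
        (funext fun b => ?_))) h4)))
    · rcases b with b | b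
      · exact congrArg Sum.inr (g.symm_apply_apply (x.1 b)).symm
      · rfl
    · rcases b with b | b
      · exact congrArg Sum.inr (congrFun (congrArg Subtype.val hτ) b).symm
      · rfl
  refine Set.Subset.antisymm ?_ (Set.singleton_subset_iff.2 ⟨x₀, hx₀, rfl⟩)
  rintro _ ⟨x, hx, rfl⟩
  exact funext fun i => fin_two_eq_iff.2 ((key x hx i).trans (key x₀ hx₀ i).symm)

end External

/-! ### Spaces of `Δ`-types. -/

section DeltaTypes

variable {L : FirstOrder.Language.{u, v}} {M : Type w} [L.Structure M] [Nonempty M]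
  {T : L.Theory} [M ⊨ T] {κ : Cardinal.{w}} {ι : Type w'} {c : ι → M} {m : ℕ}
  {Δ : Finset (L.Formula (ι ⊕ Fin m))} {P : Finset (T.CompleteType (Fin m))}

open Classical in
/-- The restriction of a global type to a `Δ`-type. -/
noncomputable def toDeltaType (Δ : Finset (L.Formula (ι ⊕ Fin m)))
    (P : Finset (T.CompleteType (Fin m))) (p : TypesExtending M (T.typeOf c)) :
    DeltaType T c Δ P :=
  ⟨fun φ b => decide (Holds p.1 φ.1 (Sum.map id b.1)), p, fun _ _ => decide_eq_true_iff⟩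

lemma toDeltaType_apply (p : TypesExtending M (T.typeOf c)) (φ : Δ) (b : Realizations M P) :
    (toDeltaType Δ P p).1 φ b = true ↔ Holds p.1 φ.1 (Sum.map id b.1) := by
  classical exact decide_eq_true_iff

lemma smul_deltaType_apply (g : M ≃[L] M) (f : DeltaType T c Δ P) (φ : Δ)
    (b : Realizations M P) : (g • f).1 φ b = f.1 φ (g⁻¹ • b) := rfl

lemma continuous_deltaType_apply (φ : Δ) (b : Realizations M P) :
    Continuous fun f : DeltaType T c Δ P => f.1 φ b :=
  (continuous_apply b).comp ((continuous_apply φ).comp continuous_subtype_val)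

lemma isClopen_deltaType (φ : Δ) (b : Realizations M P) :
    IsClopen {f : DeltaType T c Δ P | f.1 φ b = true} :=
  (isClopen_discrete {true}).preimage (continuous_deltaType_apply φ b)

instance deltaTypeCompactSpace : CompactSpace (DeltaType T c Δ P) := by
  refine Function.Surjective.compactSpace (f := toDeltaType Δ P) ?_ ?_
  · refine continuous_induced_rng.2 (continuous_pi fun φ => continuous_pi fun b => ?_)
    rw [continuous_bool_rng true]
    convert isClopen_typesExtending_holds (T.typeOf c) φ.1 (Sum.map id b.1) using 1
    ext p
    exact toDeltaType_apply p φ b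
  · rintro ⟨f, p, hp⟩
    refine ⟨p, Subtype.ext (funext fun φ => funext fun b => ?_)⟩
    rw [Bool.eq_iff_iff, toDeltaType_apply]
    exact (hp φ b).symm

lemma deltaType_ne_iff {f g : DeltaType T c Δ P} : f ≠ g ↔ ∃ b φ, f.1 φ b ≠ g.1 φ b := by
  rw [← not_iff_not]
  push Not
  exact ⟨fun h b φ => h ▸ rfl, fun h => Subtype.ext (funext fun φ => funext fun b => h b φ)⟩

/-- A self-map whose values on any `N + 1` points cannot be separated by a finite set has finite
range. -/
lemma finite_range_of_forall_exists_agree {η : DeltaType T c Δ P → DeltaType T c Δ P} {N : ℕ}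
    (h : ∀ (Y : Finset (DeltaType T c Δ P)) (S : Finset (Realizations M P)), N < Y.card →
      ∃ f₁ ∈ Y, ∃ f₂ ∈ Y, f₁ ≠ f₂ ∧ ∀ b ∈ S, ∀ φ, (η f₁).1 φ b = (η f₂).1 φ b) :
    (Set.range η).Finite := by
  classical
  by_contra hinf
  obtain ⟨Z, hZ, hcard⟩ := Set.Infinite.exists_subset_card_eq hinf (N + 1)
  obtain ⟨Y, hYinj, rfl⟩ : ∃ Y : Finset (DeltaType T c Δ P), Set.InjOn η Y ∧ Y.image η = Z := by
    obtain ⟨Y, -, h1, h2⟩ := Finset.exists_subset_injOn_image_eq_of_surjOn (f := η) Set.univ Z (by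
      intro z hz
      obtain ⟨y, rfl⟩ := hZ hz
      exact ⟨y, trivial, rfl⟩)
    exact ⟨Y, h1, h2⟩
  rw [Finset.card_image_of_injOn hYinj] at hcard
  -- Were the range infinite, `N + 1` points with distinct values would exist. One separating
  -- realization per ordered pair gives a finite set that separates all these values.
  choose b φ hb using fun x : {x : Y × Y // η x.1 ≠ η x.2} => deltaType_ne_iff.1 x.2
  obtain ⟨f₁, h₁, f₂, h₂, hne, hagree⟩ := h Y (Finset.univ.image b) (by omega)
  have hη : η f₁ ≠ η f₂ := fun he => hne (hYinj h₁ h₂ he)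
  exact hb ⟨(⟨f₁, h₁⟩, ⟨f₂, h₂⟩), hη⟩ (hagree _ (Finset.mem_image_of_mem b (Finset.mem_univ _)) _)

end DeltaTypes

/-! ### Part 3: from Ramsey degrees to finite image. -/

section Forward

variable {L : FirstOrder.Language.{u, v}} {M : Type w} [L.Structure M] [Nonempty M]
  {T : L.Theory} [M ⊨ T] {κ : Cardinal.{w}} {ι : Type w} {c : ι → M} {m : ℕ}
  {Δ : Finset (L.Formula (ι ⊕ Fin m))} {P : Finset (T.CompleteType (Fin m))}

/-- Finitely many types are realized by subtuples of a single tuple. -/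
lemma exists_tuple_typeOf_eq (hT : T.IsComplete) (hM : IsMonster L M κ)
    (P : Finset (T.CompleteType (Fin m))) :
    ∃ (k : ℕ) (a : Fin k → M) (s : P → Fin m → Fin k),
      ∀ q : P, T.typeOf (fun j => a (s q j)) = q.1 := by
  choose x hx using fun q : P => exists_typeOf_eq hM hT q.1
  obtain ⟨k, ⟨e⟩⟩ := Finite.exists_equiv_fin (P × Fin m)
  refine ⟨k, fun i => x (e.symm i).1 (e.symm i).2, fun q j => e (q, j), fun q => ?_⟩
  simp only [e.symm_apply_apply]
  exact hx q

/-- The realization of `q` inside a copy of `a`. -/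
def Copies.sub {k : ℕ} {a : Fin k → M} {s : P → Fin m → Fin k}
    (hs : ∀ q : P, T.typeOf (fun j => a (s q j)) = q.1) (q : P) (x : Copies T a) :
    Realizations M P :=
  ⟨fun j => x.1 (s q j), by
    have : T.typeOf (fun j => x.1 (s q j)) = q.1 := by
      rw [← hs q]
      refine typeOf_eq_of_realize_iff fun φ => ?_
      have := realize_iff_of_typeOf_eq x.2 (φ.relabel (s q))
      rwa [Formula.realize_relabel, Formula.realize_relabel] at this
    rw [this]
    exact q.2⟩

lemma exists_sub_smul_self_eq (hM : IsMonster L M κ) {k : ℕ} {a : Fin k → M}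
    {s : P → Fin m → Fin k} (hs : ∀ q : P, T.typeOf (fun j => a (s q j)) = q.1)
    (b : Realizations M P) :
    ∃ (q : P) (σ : M ≃[L] M), Copies.sub hs q (σ • Copies.self T a) = b := by
  obtain ⟨σ, hσ⟩ := exists_aut_apply_eq hM (realize_iff_of_typeOf_eq (hs ⟨_, b.2⟩))
  exact ⟨⟨_, b.2⟩, σ, Subtype.ext (funext hσ)⟩

/-- One tuple `a` contains realizations of all types in `P`, so evaluating `Δ`-types becomes
coloring copies of `a`. The degree bounds the colors however many `Δ`-types are recorded, which
makes `N` uniform. -/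
lemma exists_agree_of_sepFin (h : SepFinEDEERdeg T M) (hT : T.IsComplete)
    (hM : IsMonster L M κ) (c : ι → M) (Δ : Finset (L.Formula (ι ⊕ Fin m)))
    (P : Finset (T.CompleteType (Fin m))) :
    ∃ N : ℕ, ∀ {I : Type (max u v w)} [Finite I] (Y : I → Finset (DeltaType T c Δ P))
      (S : I → Finset (Realizations M P)), (∀ i, N < (Y i).card) →
      ∃ g : M ≃[L] M, ∀ i, ∃ f₁ ∈ Y i, ∃ f₂ ∈ Y i, f₁ ≠ f₂ ∧
        ∀ b ∈ S i, ∀ φ, (g • f₁).1 φ b = (g • f₂).1 φ b := by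
  classical
  obtain ⟨k, a, s, hs⟩ := exists_tuple_typeOf_eq hT hM P
  let δ : Δ × P → L.Formula (Fin k ⊕ ι) := fun x =>
    x.1.1.relabel (Sum.elim Sum.inr fun j => Sum.inl (s x.2 j))
  obtain ⟨d, hd⟩ := h k a ι (Finset.univ.image δ) (T.typeOf c)
  -- `N` bounds the number of maps from at most `d` colors to truth patterns on `Δ × P`.
  refine ⟨Fintype.card (Δ × P → Fin 2) ^ d, fun {I} _ Y S hY => ?_⟩
  obtain ⟨n, e, col, hcol⟩ := exists_coloring (T := T) a
    fun (i : (Σ i : I, Y i) × (Δ × P)) x => i.1.2.1.1 i.2.1 (Copies.sub hs i.2.2 x) = true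
  choose qb σb hσb using exists_sub_smul_self_eq hM hs
  obtain ⟨l, b, hab, hb⟩ := exists_tuple_translates (T := T) a
    fun j : Σ i : I, S i => σb j.2.1
  have hext : IsExternallyDefinableDeltaColoring (Finset.univ.image δ) (T.typeOf c) col := by
    choose p hp using fun f : DeltaType T c Δ P => f.2
    refine ⟨fun i => ⟨δ (e.symm i).2, Finset.mem_image_of_mem δ (Finset.mem_univ _)⟩,
      fun i => p (e.symm i).1.2.1, fun x i => (hcol x i).trans ((hp _ _ _).trans ?_)⟩
    rw [holds_relabel]
    refine iff_of_eq (congrArg (Holds _ _) (funext fun y => ?_))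
    rcases y with y | y <;> rfl
  obtain ⟨b', hb'⟩ := hd l b hab n col hext
  obtain ⟨τ, hτ⟩ := exists_translate_eq hM b'
  refine ⟨τ⁻¹, fun i => ?_⟩
  -- A color already records the values of every `f` in `Y i`. Two `f` with the same `Θ` therefore
  -- agree at all realizations inside copies of `a` in `b'`.
  let Θ : Y i → (col '' copiesIn T a b'.1) → Δ × P → Fin 2 :=
    fun f y x => y.1 (e (⟨i, f⟩, x))
  have hcard : Fintype.card ((col '' copiesIn T a b'.1) → Δ × P → Fin 2) <
      Fintype.card (Y i) := by
    rw [Fintype.card_fun, Fintype.card_coe]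
    refine lt_of_le_of_lt (Nat.pow_le_pow_right Fintype.card_pos ?_) (hY i)
    rwa [← Nat.card_coe_set_eq, Nat.card_eq_fintype_card] at hb'
  obtain ⟨f₁, f₂, hne, hΘ⟩ := Fintype.exists_ne_map_eq_of_card_lt Θ hcard
  refine ⟨f₁.1, f₁.2, f₂.1, f₂.2, fun h => hne (Subtype.ext h), fun y hy φ => ?_⟩
  let z : Copies T a := τ • σb y • Copies.self T a
  have hz : z ∈ copiesIn T a b'.1 := hτ (hb ⟨i, ⟨y, hy⟩⟩)
  have h1 : col z (e (⟨i, f₁⟩, (φ, qb y))) = col z (e (⟨i, f₂⟩, (φ, qb y))) :=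
    congrFun (congrFun hΘ ⟨col z, z, hz, rfl⟩) (φ, qb y)
  rw [fin_two_eq_iff, hcol, hcol, e.symm_apply_apply, e.symm_apply_apply] at h1
  have h2 : Copies.sub hs (qb y) z = τ • y := by
    conv_rhs => rw [← hσb y]
    rfl
  rw [smul_deltaType_apply, smul_deltaType_apply, inv_inv, ← h2]
  exact Bool.eq_iff_iff.2 h1

lemma exists_ellis_finite_range_of_sepFin (h : SepFinEDEERdeg T M) (hT : T.IsComplete)
    (hM : IsMonster L M κ) (c : ι → M) (Δ : Finset (L.Formula (ι ⊕ Fin m)))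
    (P : Finset (T.CompleteType (Fin m))) :
    ∃ η ∈ ellisSemigroup (M ≃[L] M) (DeltaType T c Δ P), (Set.range η).Finite := by
  obtain ⟨N, hN⟩ := exists_agree_of_sepFin h hT hM c Δ P
  have key := exists_mem_ellisSemigroup (G := M ≃[L] M) (X := DeltaType T c Δ P)
    (fun i : {Y : Finset (DeltaType T c Δ P) // N < Y.card} × Finset (Realizations M P) =>
      {η | ∃ f₁ ∈ i.1.1, ∃ f₂ ∈ i.1.1, f₁ ≠ f₂ ∧
        ∀ b ∈ i.2, ∀ φ, (η f₁).1 φ b = (η f₂).1 φ b}) ?_ ?_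
  · obtain ⟨η, hη, hη'⟩ := key
    exact ⟨η, hη, finite_range_of_forall_exists_agree fun Y S hY => hη' (⟨Y, hY⟩, S)⟩
  · rintro ⟨⟨Y, hY⟩, S⟩
    have h0 : ∀ f₁ f₂ : DeltaType T c Δ P, IsClosed {η : DeltaType T c Δ P → DeltaType T c Δ P |
        f₁ ≠ f₂ ∧ ∀ b ∈ S, ∀ φ, (η f₁).1 φ b = (η f₂).1 φ b} := by
      intro f₁ f₂
      refine isClosed_const.and ?_
      simp only [Set.ofPred_forall]
      refine isClosed_iInter fun b => isClosed_iInter fun _ => isClosed_iInter fun φ => ?_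
      exact isClosed_eq ((continuous_deltaType_apply φ b).comp (continuous_apply f₁))
        ((continuous_deltaType_apply φ b).comp (continuous_apply f₂))
    -- The agreeing pair may change with `S`; since `Y` is finite, the disjunction over its pairs is
    -- still a closed condition.
    have h1 := Y.finite_toSet.isClosed_biUnion fun f₁ _ =>
      Y.finite_toSet.isClosed_biUnion fun f₂ _ => h0 f₁ f₂
    convert h1 using 1
    ext η
    simp only [Set.mem_iUnion, Set.mem_ofPred_eq, exists_prop, SetLike.mem_coe]
  · intro S
    obtain ⟨g, hg⟩ := hN (I := S) (fun i => i.1.1.1) (fun i => i.1.2) fun i => i.1.1.2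
    exact ⟨g, fun i hi => hg ⟨i, hi⟩⟩

end Forward

/-! ### Part 3: from finite image to Ramsey degrees. -/

section Backward

variable {L : FirstOrder.Language.{u, v}} {M : Type w} [L.Structure M] [Nonempty M]
  {T : L.Theory} [M ⊨ T] {κ : Cardinal.{w}} {ι : Type w} {c : ι → M}

/-- A copy of `a` as a realization of its type. -/
def Copies.toRealization {k : ℕ} {a : Fin k → M} (x : Copies T a) :
    Realizations M ({T.typeOf a} : Finset (T.CompleteType (Fin k))) :=
  ⟨x.1, Finset.mem_singleton.2 x.2⟩

lemma sepFin_of_exists_ellis_finite_range (hM : IsMonster L M κ) (hc : Function.Surjective c)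
    (h : ∀ (m : ℕ) (Δ : Finset (L.Formula (ι ⊕ Fin m))) (P : Finset (T.CompleteType (Fin m))),
      ∃ η ∈ ellisSemigroup (M ≃[L] M) (DeltaType T c Δ P), (Set.range η).Finite) :
    SepFinEDEERdeg T M := by
  classical
  intro k a γ Δ q
  rcases isEmpty_or_nonempty (TypesExtending M q) with hemp | ⟨⟨p₀⟩⟩
  -- Without a global extension of `q`, a coloring exists only for `n = 0`, and there is a single
  -- color.
  · refine ⟨1, fun l b _ n col ⟨φ, p, _⟩ => ⟨Copies.self T b, ?_⟩⟩
    have : IsEmpty (Fin n) := ⟨fun i => hemp.false (p i)⟩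
    exact Set.ncard_le_one_of_subsingleton _
  obtain ⟨r, s, φ', hφ⟩ := exists_relabel_iff fun φ : Δ => φ.1
  -- All extensions of `q` agree over the empty set, so the indices found for `p₀` work for every
  -- `p`, and one finite `Δ'` serves all colorings.
  obtain ⟨e, he⟩ := exists_lift_of_surjective (T := T) hM hc p₀.1 s
  choose lift hlift using fun p : TypesExtending M q =>
    he p.1 fun φ => (holds_inl_iff p φ).trans (holds_inl_iff p₀ φ).symm
  let δ : Δ → L.Formula (ι ⊕ Fin k) := fun φ =>
    (φ' φ).relabel (Sum.elim Sum.inr fun j => Sum.inl (e j))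
  let Δ' : Finset (L.Formula (ι ⊕ Fin k)) := Finset.univ.image δ
  let δ' : Δ → Δ' := fun φ => ⟨δ φ, Finset.mem_image_of_mem δ (Finset.mem_univ _)⟩
  obtain ⟨η, hη, hfin⟩ := h k Δ' {T.typeOf a}
  have := hfin.to_subtype
  refine ⟨Nat.card (Set.range η → Δ → Bool), fun l b hab n col ⟨φ, p, hcol⟩ => ?_⟩
  have := (copiesIn_finite (T := T) a b).to_subtype
  obtain ⟨g, hg⟩ := exists_smul_mem_iff hη
    (fun i : copiesIn T a b × Fin n => toDeltaType Δ' {T.typeOf a} (lift (p i.2)))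
    (fun i => {f | f.1 (δ' (φ i.2)) i.1.1.toRealization = true})
    fun i => isClopen_deltaType _ _
  have key : ∀ x ∈ copiesIn T a (Copies.translate T g⁻¹ b).1, ∀ i, col x i = 1 ↔
      (η (toDeltaType Δ' {T.typeOf a} (lift (p i)))).1 (δ' (φ i)) (g • x).toRealization =
        true := by
    intro x hx i
    have hx' := inv_smul_mem_copiesIn g⁻¹ hx
    rw [inv_inv] at hx'
    refine Iff.trans ?_ (hg (⟨g • x, hx'⟩, i))
    change _ ↔ (toDeltaType Δ' {T.typeOf a} (lift (p i))).1 (δ' (φ i))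
      (g⁻¹ • (g • x).toRealization) = true
    have h1 : g⁻¹ • (g • x).toRealization = x.toRealization :=
      Subtype.ext (funext fun j => g.symm_apply_apply (x.1 j))
    rw [h1, toDeltaType_apply, hcol, holds_congr _ (hφ (φ i)), holds_relabel]
    have h2 := hlift (p i) (φ' (φ i)) x.1
    refine Iff.trans (iff_of_eq (congrArg (Holds _ _) (funext fun y => ?_)))
      (h2.symm.trans (Iff.trans (iff_of_eq (congrArg (Holds _ _) (funext fun y => ?_)))
        (holds_relabel (lift (p i)).1 (φ' (φ i))
          (Sum.elim Sum.inr fun j => Sum.inl (e j)) _).symm))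
    · rcases y with y | y <;> rfl
    · rcases y with y | y <;> rfl
  refine ⟨Copies.translate T g⁻¹ b, ?_⟩
  -- The color of `x` is decoded from the values at `g • x` of the members of `Set.range η`; the
  -- number of such tables does not depend on `n` or `b`.
  let Ψ : (Set.range η → Δ → Bool) → Fin n → Fin 2 := fun v i =>
    if v ⟨η (toDeltaType Δ' {T.typeOf a} (lift (p i))), _, rfl⟩ (φ i) then 1 else 0
  have hsub : col '' copiesIn T a (Copies.translate T g⁻¹ b).1 ⊆ Set.range Ψ := by
    rintro _ ⟨x, hx, rfl⟩
    refine ⟨fun f φ => f.1.1 (δ' φ) (g • x).toRealization, funext fun i => ?_⟩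
    rw [fin_two_eq_iff, key x hx i]
    simp [Ψ]
  refine (Set.ncard_le_ncard hsub (Set.toFinite _)).trans ?_
  rw [← Set.image_univ, ← Set.ncard_univ]
  exact Set.ncard_image_le Set.finite_univ

end Backward

/-! ### Regular measures determined by clopen sets. -/

section Measures

open MeasureTheory

/-- Weights on finitely many points, as a probability measure. -/
lemma exists_probabilityMeasure_real_eq {X : Type*} [MeasurableSpace X] {R : ℕ} (lam : Fin R → ℝ)
    (hlam : ∀ t, 0 ≤ lam t) (hsum : ∑ t, lam t = 1) (x : Fin R → X) :
    ∃ μ : ProbabilityMeasure X, ∀ C : Set X, MeasurableSet C →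
      (μ : Measure X).real C = ∑ t, lam t * C.indicator 1 (x t) := by
  let μ : Measure X := ∑ t, ENNReal.ofReal (lam t) • Measure.dirac (x t)
  have hnn : ∀ (C : Set X) (t : Fin R), 0 ≤ lam t * C.indicator 1 (x t) := fun C t =>
    mul_nonneg (hlam t) (Set.indicator_nonneg (fun _ _ => zero_le_one) _)
  have happ : ∀ C : Set X, MeasurableSet C →
      μ C = ENNReal.ofReal (∑ t, lam t * C.indicator 1 (x t)) := by
    intro C hC
    rw [ENNReal.ofReal_sum_of_nonneg fun t _ => hnn C t]
    simp only [μ, Measure.coe_finsetSum, Finset.sum_apply, Measure.smul_apply, smul_eq_mul]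
    refine Finset.sum_congr rfl fun t _ => ?_
    rw [Measure.dirac_apply' _ hC]
    by_cases h : x t ∈ C <;> simp [h]
  have hprob : IsProbabilityMeasure μ := ⟨by rw [happ _ MeasurableSet.univ]; simp [hsum]⟩
  refine ⟨⟨μ, hprob⟩, fun C hC => ?_⟩
  change (μ C).toReal = _
  rw [happ C hC, ENNReal.toReal_ofReal]
  exact Finset.sum_nonneg fun t _ => hnn C t

variable {X : Type*} [TopologicalSpace X] [MeasurableSpace X]

/-- Open sets are measured from inside by compact sets, and a member of `𝓑` fits between the two. -/
lemma regular_ext_of_forall_between (𝓑 : Set (Set X))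
    (h𝓑 : ∀ K U : Set X, IsCompact K → IsOpen U → K ⊆ U → ∃ C ∈ 𝓑, K ⊆ C ∧ C ⊆ U)
    {μ ν : Measure X} [μ.Regular] [ν.Regular] (h : ∀ C ∈ 𝓑, μ C = ν C) : μ = ν := by
  have key : ∀ {μ ν : Measure X} [μ.Regular] [ν.Regular], (∀ C ∈ 𝓑, μ C = ν C) →
      ∀ U, IsOpen U → μ U ≤ ν U := by
    intro μ ν _ _ h U hU
    rw [hU.measure_eq_iSup_isCompact]
    refine iSup₂_le fun K hKU => iSup_le fun hK => ?_
    obtain ⟨C, hC, hKC, hCU⟩ := h𝓑 K U hK hU hKU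
    exact (measure_mono hKC).trans ((h C hC).trans_le (measure_mono hCU))
  exact Measure.OuterRegular.ext_isOpen fun U hU =>
    (key h U hU).antisymm (key (fun C hC => (h C hC).symm) U hU)

variable [BorelSpace X]

lemma integral_indicator_isClopen (μ : Measure X) {C : Set X} (hC : IsClopen C) :
    ∫ x, BoundedContinuousFunction.indicator C hC x ∂μ = μ.real C :=
  integral_indicator_one hC.isOpen.measurableSet

lemma continuous_real_isClopen {C : Set X} (hC : IsClopen C) :
    Continuous fun μ : ProbabilityMeasure X => (μ : Measure X).real C := by
  simp only [← integral_indicator_isClopen _ hC]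
  exact ProbabilityMeasure.continuous_integral_boundedContinuousFunction _

/-- Equalities between the measures of clopen sets that can be satisfied approximately by
probability measures, finitely many at a time, can be satisfied exactly by a regular one. -/
lemma exists_regular_measure_eq [T2Space X] [CompactSpace X] {K : Type*} (C D : K → Set X)
    (hC : ∀ i, IsClopen (C i)) (hD : ∀ i, IsClopen (D i))
    (h : ∀ (S : Finset K) (ε : ℝ), 0 < ε → ∃ μ : ProbabilityMeasure X, ∀ i ∈ S,
      |(μ : Measure X).real (C i) - (μ : Measure X).real (D i)| ≤ ε) :
    ∃ μ : Measure X, IsProbabilityMeasure μ ∧ μ.Regular ∧ ∀ i, μ (C i) = μ (D i) := by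
  classical
  have key := CompactSpace.iInter_nonempty (X := ProbabilityMeasure X)
    (t := fun i : K × {ε : ℝ // 0 < ε} =>
      {μ | |(μ : Measure X).real (C i.1) - (μ : Measure X).real (D i.1)| ≤ i.2}) ?_ ?_
  · obtain ⟨μ, hμ⟩ := key
    rw [Set.mem_iInter] at hμ
    -- The limit measure need not be regular. A regular one with the same integrals of continuous
    -- functions has the same values on clopen sets, whose indicators are continuous.
    obtain ⟨ν, hreg, hfin, hν⟩ := Measure.exists_regular_eq_of_compactSpace (μ : Measure X)
    have hclopen : ∀ {E : Set X}, IsClopen E → ν.real E = (μ : Measure X).real E := by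
      intro E hE
      rw [← integral_indicator_isClopen ν hE, ← integral_indicator_isClopen _ hE, hν]
    refine ⟨ν, ⟨?_⟩, hreg, fun i => ?_⟩
    · have := hclopen isClopen_univ
      rw [probReal_univ (μ := (μ : Measure X))] at this
      exact (ENNReal.toReal_eq_one_iff _).1 this
    · rw [← measureReal_eq_measureReal_iff, hclopen (hC i), hclopen (hD i), ← sub_eq_zero,
        ← abs_nonpos_iff]
      exact le_of_forall_pos_le_add fun ε hε => by
        rw [zero_add]
        exact hμ (i, ⟨ε, hε⟩)
  · intro i
    exact isClosed_le (((continuous_real_isClopen (hC i.1)).sub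
      (continuous_real_isClopen (hD i.1))).abs) continuous_const
  · intro S
    obtain ⟨ε, hε, hεS⟩ : ∃ ε : ℝ, 0 < ε ∧ ∀ i ∈ S, ε ≤ i.2 := by
      rcases S.eq_empty_or_nonempty with rfl | hS
      · exact ⟨1, one_pos, fun i hi => absurd hi (Finset.notMem_empty i)⟩
      · obtain ⟨i, -, hi⟩ := S.exists_min_image Prod.snd hS
        exact ⟨i.2, i.2.2, hi⟩
    obtain ⟨μ, hμ⟩ := h (S.image Prod.fst) ε hε
    refine ⟨μ, Set.mem_iInter₂.2 fun i hi => ?_⟩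
    exact (hμ i.1 (Finset.mem_image_of_mem _ hi)).trans (hεS i hi)

end Measures

/-! ### Invariance of measures on type spaces. -/

section Invariance

variable {L : FirstOrder.Language.{u, v}} {M : Type w} [L.Structure M] {T : L.Theory}

lemma continuous_smul_typesExtending {α : Type*} {q : T.CompleteType α} (σ : M ≃[L] M) :
    Continuous fun p : TypesExtending M q => σ • p := by
  refine continuous_induced_rng.2
    (CompleteType.isTopologicalBasis_range_typesWith.continuous_iff.2 ?_)
  rintro _ ⟨s, rfl⟩
  exact (CompleteType.isOpen_typesWith
    ((shift (σ⁻¹ : M ≃[L] M) α).onSentence s)).preimage continuous_subtype_val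

/-- A compact set is covered by finitely many basic sets inside `U`, and their union is again given
by one formula. -/
lemma exists_holds_between {α : Type*} {q : T.CompleteType α} {K U : Set (TypesExtending M q)}
    (hK : IsCompact K) (hU : IsOpen U) (hKU : K ⊆ U) :
    ∃ ψ : L.Formula (α ⊕ M), K ⊆ {p | Holds p.1 ψ id} ∧ {p | Holds p.1 ψ id} ⊆ U := by
  refine hK.induction_on (p := fun K => ∃ ψ : L.Formula (α ⊕ M),
    K ⊆ {p | Holds p.1 ψ id} ∧ {p : TypesExtending M q | Holds p.1 ψ id} ⊆ U) ?_ ?_ ?_ ?_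
  · exact ⟨⊥, Set.empty_subset _, fun p hp => (holds_bot p.1 id hp).elim⟩
  · rintro K₁ K₂ h12 ⟨ψ, h1, h2⟩
    exact ⟨ψ, h12.trans h1, h2⟩
  · rintro K₁ K₂ ⟨ψ₁, h1, h2⟩ ⟨ψ₂, h3, h4⟩
    refine ⟨ψ₁ ⊔ ψ₂, ?_, fun p hp => ((holds_sup _ _ _ _).1 hp).elim (fun h => h2 h) fun h => h4 h⟩
    exact Set.union_subset (fun p hp => (holds_sup _ _ _ _).2 (Or.inl (h1 hp)))
      fun p hp => (holds_sup _ _ _ _).2 (Or.inr (h3 hp))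
  · intro p hp
    obtain ⟨V, hV, rfl⟩ := isOpen_induced_iff.1 hU
    obtain ⟨ψ, h1, h2⟩ := exists_holds_subset hV (hKU hp)
    exact ⟨_, mem_nhdsWithin_of_mem_nhds
      ((isClopen_typesExtending_holds q ψ id).isOpen.mem_nhds h1), ψ, subset_rfl,
      fun p' hp' => h2 p'.1 hp'⟩

/-- A regular measure that is invariant on formulas is invariant. -/
lemma measure_preimage_smul_eq {α : Type*} {q : T.CompleteType α}
    (μ : MeasureTheory.Measure (TypesExtending M q)) [μ.Regular]
    (h : ∀ (σ : M ≃[L] M) (ψ : L.Formula (α ⊕ M)),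
      μ {p | Holds p.1 ψ (Sum.map id σ)} = μ {p | Holds p.1 ψ id})
    (σ : M ≃[L] M) {B : Set (TypesExtending M q)} (hB : MeasurableSet B) :
    μ ((fun p => σ • p) ⁻¹' B) = μ B := by
  let e : TypesExtending M q ≃ₜ TypesExtending M q :=
    { MulAction.toPerm σ with
      continuous_toFun := continuous_smul_typesExtending σ
      continuous_invFun := continuous_smul_typesExtending σ⁻¹ }
  have hreg : (μ.map e).Regular := MeasureTheory.Measure.Regular.map e
  have heq : μ.map e = μ := by
    refine regular_ext_of_forall_between (Set.range fun ψ : L.Formula (α ⊕ M) =>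
      {p : TypesExtending M q | Holds p.1 ψ id}) (fun K U hK hU hKU => ?_) ?_
    · obtain ⟨ψ, h1, h2⟩ := exists_holds_between hK hU hKU
      exact ⟨_, ⟨ψ, rfl⟩, h1, h2⟩
    · rintro _ ⟨ψ, rfl⟩
      rw [MeasureTheory.Measure.map_apply e.continuous.measurable
        (isClopen_typesExtending_holds q ψ id).isOpen.measurableSet, ← h σ⁻¹ ψ]
      exact congrArg μ (Set.ext fun p => holds_smul σ p.1 ψ id)
  exact (MeasureTheory.Measure.map_apply e.continuous.measurable hB).symm.trans (by rw [heq])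

end Invariance

/-! ### Part 4: convex combinations and invariant measures. -/

section Amenable

open MeasureTheory

variable {L : FirstOrder.Language.{u, v}} {M : Type w} [L.Structure M] [Nonempty M]
  {T : L.Theory} [M ⊨ T] {κ : Cardinal.{w}}

lemma fin_two_cast_eq_indicator {X : Type*} {y : Fin 2} {C : Set X} {x : X}
    (h : y = 1 ↔ x ∈ C) : ((y : ℕ) : ℝ) = C.indicator 1 x := by
  by_cases hx : x ∈ C
  · rw [h.2 hx, Set.indicator_of_mem hx]
    simp
  · have h0 : y = 0 := by
      have := mt h.1 hx
      omega
    rw [h0, Set.indicator_of_notMem hx]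
    simp

lemma isAmenable_of_DEECRP (hT : T.IsComplete) (hM : IsMonster L M κ) (h : DEECRP T M) :
    IsAmenable T M := by
  intro n q
  obtain ⟨m, rfl⟩ := exists_typeOf_eq hM hT q
  obtain ⟨μ, hprob, hreg, hμ⟩ := exists_regular_measure_eq
    (fun i : (M ≃[L] M) × L.Formula (Fin n ⊕ M) =>
      {p : TypesExtending M (T.typeOf m) | Holds p.1 i.2 (Sum.map id i.1)})
    (fun i => {p | Holds p.1 i.2 id}) (fun i => isClopen_typesExtending_holds _ _ _)
    (fun i => isClopen_typesExtending_holds _ _ _) fun S ε hε => by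
      obtain ⟨k, a, ψ', hψ⟩ := exists_relabel_iff fun i : S => i.1.2
      obtain ⟨N, e, c, hc⟩ := exists_coloring (T := T) a
        fun i x => (ψ' i).Realize (Sum.elim m x.1)
      obtain ⟨l, b, hab, hb⟩ := exists_tuple_translates (T := T) a fun i : S => i.1.1
      obtain ⟨R, lam, σ, hlam, hsum, hσ⟩ := h ε hε k l a b hab N c
        ((isDefinableColoring_iff c).2 ⟨n, m, fun i => ψ' (e.symm i), hc⟩)
      -- Put mass `lam t` on the type of `(σ t)⁻¹m`. The measure of a formula shifted by `τ` is then
      -- the weighted color of `τa`.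
      obtain ⟨μ, hμ⟩ := exists_probabilityMeasure_real_eq lam (fun t => (hlam t).1) hsum
        fun t => conjType T m (σ t)⁻¹
      refine ⟨μ, fun i hi => ?_⟩
      have key : ∀ (τ : M ≃[L] M) (t : Fin R),
          ((c (σ t • τ • Copies.self T a) (e ⟨i, hi⟩) : ℕ) : ℝ) =
            {p : TypesExtending M (T.typeOf m) | Holds p.1 i.2 (Sum.map id τ)}.indicator 1
              (conjType T m (σ t)⁻¹) := by
        intro τ t
        refine fin_two_cast_eq_indicator ?_
        rw [hc, e.symm_apply_apply]
        exact (holds_conjType_inv (T := T) m (hψ ⟨i, hi⟩) (σ t) τ).symm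
      have h1 := key 1
      simp only [sum_map_one, one_smul] at h1
      have h2 := hσ _ (hb ⟨i, hi⟩) (Copies.self T a) hab (e ⟨i, hi⟩)
      rw [hμ _ (isClopen_typesExtending_holds _ _ _).isOpen.measurableSet,
        hμ _ (isClopen_typesExtending_holds _ _ _).isOpen.measurableSet]
      simp only [← h1, ← key]
      exact h2
  exact ⟨μ, hprob, hreg, fun σ B hB =>
    measure_preimage_smul_eq μ (fun σ ψ => hμ (σ, ψ)) σ hB⟩

lemma DEECRP_of_strongDEECRP (h : StrongDEECRP T M) : DEECRP T M := by
  intro ε hε k l a b hab n c hc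
  obtain ⟨R, lam, σ, h1, h2, h3⟩ := h k l a b hab n c hc
  exact ⟨R, lam, σ, h1, h2, fun x hx y hy i => (h3 x hx y hy i).trans hε.le⟩

/-- The type space splits into finitely many pieces according to truth over the copies of `a` in
`b`. Weighting an automorphism realizing each pattern by the measure of its piece makes the averaged
color of `x` exactly `μ (E x i)`, which invariance makes independent of `x`. -/
lemma strongDEECRP_of_isAmenable (hM : IsMonster L M κ) (h : IsAmenable T M) :
    StrongDEECRP T M := by
  classical
  intro k l a b hab n c hc
  obtain ⟨r, m, ψ, hψ⟩ := (isDefinableColoring_iff c).1 hc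
  obtain ⟨μ, hprob, -, hμ⟩ := h r (T.typeOf m)
  have := (copiesIn_finite (T := T) a b).fintype
  let E : Copies T a → Fin n → Set (TypesExtending M (T.typeOf m)) := fun x i =>
    {p | Holds p.1 (ψ i) (Sum.map id x.1)}
  have hE : ∀ x i, MeasurableSet (E x i) := fun x i =>
    (isClopen_typesExtending_holds _ _ _).isOpen.measurableSet
  let pat : TypesExtending M (T.typeOf m) → (copiesIn T a b × Fin n → Bool) :=
    fun p z => decide (p ∈ E z.1.1 z.2)
  have hpat : ∀ s, MeasurableSet (pat ⁻¹' s) := by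
    have : Measurable pat := measurable_pi_lambda _ fun z => measurable_to_bool (by
      convert hE z.1.1 z.2 using 1
      ext p
      exact decide_eq_true_iff)
    exact fun s => this (Set.toFinite s).measurableSet
  have hreal : ∀ v, ∃ σ : M ≃[L] M, μ.real (pat ⁻¹' {v}) ≠ 0 →
      ∀ z, c (σ • z.1.1) z.2 = 1 ↔ v z = true := by
    intro v
    by_cases hv : μ.real (pat ⁻¹' {v}) = 0
    -- A pattern of measure zero may not be realized; its weight vanishes, so any automorphism will
    -- do.
    · exact ⟨1, fun h => (h hv).elim⟩
    · obtain ⟨p, rfl⟩ : (pat ⁻¹' {v}).Nonempty := by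
        by_contra hne
        rw [Set.not_nonempty_iff_eq_empty] at hne
        exact hv (by rw [hne, measureReal_empty])
      obtain ⟨σ, hσ⟩ := exists_aut_realize_iff hM p ψ a b
      refine ⟨σ, fun _ z => ?_⟩
      rw [hψ, ← hσ _ z.1.2]
      exact decide_eq_true_iff.symm
  choose σ hσ using hreal
  have hsum : ∀ (x : copiesIn T a b) (i : Fin n),
      ∑ v, μ.real (pat ⁻¹' {v}) * ((c (σ v • x.1) i : ℕ) : ℝ) = μ.real (E x.1 i) := by
    intro x i
    have h1 : E x.1 i = pat ⁻¹' (Finset.univ.filter fun v => v (x, i) = true :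
        Finset (copiesIn T a b × Fin n → Bool)) := by
      ext p
      simp [pat]
    rw [h1, ← sum_measureReal_preimage_singleton _ fun v _ => hpat {v}, Finset.sum_filter]
    refine Finset.sum_congr rfl fun v _ => ?_
    by_cases hv : μ.real (pat ⁻¹' {v}) = 0
    · simp [hv]
    · have h2 := fin_two_cast_eq_indicator 
        (C := {v : copiesIn T a b × Fin n → Bool | v (x, i) = true}) (hσ v hv (x, i))
      rw [h2]
      by_cases h3 : v (x, i) = true <;> simp [h3]
  have hinv : ∀ (x y : Copies T a) (i : Fin n), μ.real (E x i) = μ.real (E y i) := by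
    intro x y i
    obtain ⟨τ, rfl⟩ := exists_smul_eq hM x y
    refine congrArg ENNReal.toReal ((hμ τ _ (hE _ i)).symm.trans
      (congrArg μ (Set.ext fun p => ?_))).symm
    refine (holds_smul τ p.1 (ψ i) _).trans (iff_of_eq (congrArg (Holds p.1 (ψ i))
      (funext fun z => ?_)))
    rcases z with z | z
    · rfl
    · exact congrArg Sum.inr (τ.symm_apply_apply (x.1 z))
  obtain ⟨R, ⟨e⟩⟩ := Finite.exists_equiv_fin (copiesIn T a b × Fin n → Bool)
  refine ⟨R, fun t => μ.real (pat ⁻¹' {e.symm t}), fun t => σ (e.symm t),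
    fun t => ⟨measureReal_nonneg, measureReal_le_one⟩, ?_, fun x hx y hy i => ?_⟩
  · rw [e.symm.sum_comp fun v => μ.real (pat ⁻¹' {v}),
      sum_measureReal_preimage_singleton _ fun v _ => hpat {v}]
    simp
  · rw [e.symm.sum_comp fun v => μ.real (pat ⁻¹' {v}) * ((c (σ v • x) i : ℕ) : ℝ),
      e.symm.sum_comp fun v => μ.real (pat ⁻¹' {v}) * ((c (σ v • y) i : ℕ) : ℝ),
      hsum ⟨x, hx⟩, hsum ⟨y, hy⟩, hinv x y, sub_self, abs_zero]

end Amenable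

end DefRamsey

theorem mainTheorem1 {L : FirstOrder.Language.{u, v}} (T : L.Theory) (hT : T.IsComplete)
    (M : Type w) [L.Structure M] [Nonempty M] [M ⊨ T]
    (κ : Cardinal.{w}) (hM : DefRamsey.IsMonster L M κ)
    {ι : Type w} (c : ι → M) (hc : Function.Bijective c) :
    (DefRamsey.DEERP T M ↔ DefRamsey.IsExtremelyAmenable T M) ∧
    (DefRamsey.EDEERP T M ↔
      ∃ η ∈ DefRamsey.ellisSemigroup (M ≃[L] M) (DefRamsey.TypesExtending M (T.typeOf c)),
        Set.range η ⊆
          MulAction.fixedPoints (M ≃[L] M) (DefRamsey.TypesExtending M (T.typeOf c))) ∧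
    (DefRamsey.SepFinEDEERdeg T M ↔
      ∀ (m : ℕ) (Δ : Finset (L.Formula (ι ⊕ Fin m))) (P : Finset (T.CompleteType (Fin m))),
        ∃ η ∈ DefRamsey.ellisSemigroup (M ≃[L] M) (DefRamsey.DeltaType T c Δ P),
          (Set.range η).Finite) ∧
    (DefRamsey.DEECRP T M ↔ DefRamsey.IsAmenable T M) ∧
    (DefRamsey.StrongDEECRP T M ↔ DefRamsey.IsAmenable T M) := by
  exact ⟨⟨DefRamsey.isExtremelyAmenable_of_DEERP hT hM,
      DefRamsey.DEERP_of_isExtremelyAmenable hM⟩,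
    ⟨DefRamsey.exists_ellis_of_EDEERP hM c, DefRamsey.EDEERP_of_exists_ellis hM hc.surjective⟩,
    ⟨fun h _ Δ P => DefRamsey.exists_ellis_finite_range_of_sepFin h hT hM c Δ P,
      DefRamsey.sepFin_of_exists_ellis_finite_range hM hc.surjective⟩,
    ⟨DefRamsey.isAmenable_of_DEECRP hT hM, fun h =>
      DefRamsey.DEECRP_of_strongDEECRP (DefRamsey.strongDEECRP_of_isAmenable hM h)⟩,
    ⟨fun h => DefRamsey.isAmenable_of_DEECRP hT hM (DefRamsey.DEECRP_of_strongDEECRP h),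
      DefRamsey.strongDEECRP_of_isAmenable hM⟩⟩
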